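/- Let $d\ge 1$, let $\sigma$ be a probability measure on $\mathbb R^d$ with $\sigma(\{0\})=0$, let $(\Delta_i)_{i\ge1}$ be i.i.d. random vectors with law $\sigma$ and, independently of them, let $(T_i)_{i\ge1}$ be the partial sums of a sequence of i.i.d. exponential random variables with parameter $\alpha>0$. Write $\lambda$ for Lebesgue measure on $\mathbb R$, $\lambda_A$ for its restriction to a Borel set $A$, $\mu^{*p}$ for the $p$-fold convolution power of a measure $\mu$ on $\mathbb R$, $(\lambda_A\otimes\sigma)h^{-1}$ for the image of $\lambda_A\otimes\sigma$ under $h$, and $\mathcal L(X)$ for the law of $X$. Let $h_n$ ($n\in\mathbb N$) and $h$ be measurable functions $\mathbb R_+\times\mathbb R^d\to\mathbb R$ such that, for each $k\in\{h\}\cup\{h_n:n\in\mathbb N\}$, $$\int_0^{\infty}\!\!\int_{\mathbb R^d\setminus\{0\}}(|k(t,x)|^2\wedge 1)\,dt\,\sigma(dx)<\infty$$ and the limit $$a(k):=\lim_{s\to\infty}\int_0^{s}\!\!\int_{\mathbb R^d\setminus\{0\}}k(t,x)\,\mathbf 1_{\{|k(t,x)|\le 1\}}\,dt\,\sigma(dx)$$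 exists in $\mathbb R$. Suppose that 1. $\lim_{n\to\infty}a(h_n)=a(h)$; 2. $\lim_{n\to\infty}\int_0^{\infty}\int_{\mathbb R^d\setminus\{0\}}(|h_n(t,x)-h(t,x)|^2\wedge1)\,dt\,\sigma(dx)=0$; 3. for some integer $p\ge1$, $\big((\lambda_{\mathbb R_+}\otimes\sigma)h^{-1}\big)^{*p}\ll\lambda$ and, for every $t>0$, $\big((\lambda_{[0,t]}\otimes\sigma)h_n^{-1}\big)^{*p}\to\big((\lambda_{[0,t]}\otimes\sigma)h^{-1}\big)^{*p}$ in total variation as $n\to\infty$. Then the shot noise series $I_n=\sum_{i\ge1}h_n(T_i,\Delta_i)$ and $I=\sum_{i\ge1}h(T_i,\Delta_i)$ converge almost surely, and $\mathcal L(I_n)\to\mathcal L(I)$ in total variation as $n\to\infty$. -/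

import Mathlib

open MeasureTheory ProbabilityTheory Filter Topology

noncomputable section

namespace ShotNoise

/-- The `p`-fold convolution power of a measure on the real line. -/
def convPow (μ : Measure ℝ) : ℕ → Measure ℝ
  | 0 => Measure.dirac 0
  | p + 1 => Measure.conv (convPow μ p) μ

instance convPow_isFiniteMeasure (μ : Measure ℝ) [IsFiniteMeasure μ] (p : ℕ) :
    IsFiniteMeasure (convPow μ p) := by
  induction p with
  | zero => unfold convPow; infer_instance
  | succ p ih => unfold convPow; infer_instance

/-- The total variation norm `‖μ - ν‖` of the difference of two finite measures on `ℝ`, that is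
the total mass of the positive part plus the total mass of the negative part in the Jordan
decomposition of `μ - ν`. -/
def tvNorm (μ ν : Measure ℝ) [IsFiniteMeasure μ] [IsFiniteMeasure ν] : ENNReal :=
  (μ.toSignedMeasure - ν.toSignedMeasure).totalVariation Set.univ

/-- Convergence in total variation of a sequence of finite measures on `ℝ`. -/
def TendstoInVariation (μs : ℕ → Measure ℝ) (μ : Measure ℝ)
    [∀ n, IsFiniteMeasure (μs n)] [IsFiniteMeasure μ] : Prop :=
  Tendsto (fun n => tvNorm (μs n) μ) atTop (𝓝 0)

variable {d : ℕ}

/-- The image measure `(λ_A ⊗ σ) h⁻¹` on `ℝ`. -/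
def imageMeasure (σ : Measure (EuclideanSpace ℝ (Fin d))) (A : Set ℝ)
    (h : ℝ × EuclideanSpace ℝ (Fin d) → ℝ) : Measure ℝ :=
  ((volume.restrict A).prod σ).map h

instance imageMeasure_isFiniteMeasure (σ : Measure (EuclideanSpace ℝ (Fin d)))
    [IsFiniteMeasure σ] (t : ℝ) (h : ℝ × EuclideanSpace ℝ (Fin d) → ℝ) :
    IsFiniteMeasure (imageMeasure σ (Set.Icc 0 t) h) := by
  unfold imageMeasure; infer_instance

/-- The integral `∫₀^∞ ∫_{ℝ^d ∖ {0}} (|h(t,x)|² ∧ 1) dt σ(dx)`. -/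
def truncSq (σ : Measure (EuclideanSpace ℝ (Fin d)))
    (h : ℝ × EuclideanSpace ℝ (Fin d) → ℝ) : ENNReal :=
  ∫⁻ z, ENNReal.ofReal (min (|h z| ^ 2) 1)
    ∂((volume.restrict (Set.Ici (0 : ℝ))).prod (σ.restrict {0}ᶜ))

/-- The integral `∫₀^s ∫_{ℝ^d ∖ {0}} h(t,x) 𝟙_{|h(t,x)| ≤ 1} dt σ(dx)`. -/
def truncMean (σ : Measure (EuclideanSpace ℝ (Fin d)))
    (h : ℝ × EuclideanSpace ℝ (Fin d) → ℝ) (s : ℝ) : ℝ :=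
  ∫ z, Set.indicator {z | |h z| ≤ 1} h z
    ∂((volume.restrict (Set.Icc (0 : ℝ) s)).prod (σ.restrict {0}ᶜ))

/-- The drift `a(h)`, the limit of `truncMean σ h s` as `s → ∞`. -/
def drift (σ : Measure (EuclideanSpace ℝ (Fin d)))
    (h : ℝ × EuclideanSpace ℝ (Fin d) → ℝ) : ℝ :=
  limUnder atTop (truncMean σ h)

/-- The conditions on a measurable kernel `h` under which the shot noise series is well defined.
Only the values `h (t, x)` with `0 ≤ t` matter. -/
structure IsKernel (σ : Measure (EuclideanSpace ℝ (Fin d)))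
    (h : ℝ × EuclideanSpace ℝ (Fin d) → ℝ) : Prop where
  measurable : Measurable h
  truncSq_lt_top : truncSq σ h < ⊤
  exists_drift : ∃ a : ℝ, Tendsto (truncMean σ h) atTop (𝓝 a)

variable {Ω : Type*}

/-- The marked arrivals: `τ` is an i.i.d. sequence of exponential variables of rate `α` (the
inter-arrival times), `Δ` is an i.i.d. sequence with law `σ`, and the two sequences are
independent. -/
structure IsInput [MeasurableSpace Ω] (P : Measure Ω) (α : ℝ)
    (σ : Measure (EuclideanSpace ℝ (Fin d)))
    (τ : ℕ → Ω → ℝ) (Δ : ℕ → Ω → EuclideanSpace ℝ (Fin d)) : Prop where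
  measurable_τ : ∀ i, Measurable (τ i)
  measurable_Δ : ∀ i, Measurable (Δ i)
  law_τ : ∀ i, P.map (τ i) = expMeasure α
  law_Δ : ∀ i, P.map (Δ i) = σ
  indep_τ : iIndepFun τ P
  indep_Δ : iIndepFun Δ P
  indep : IndepFun (fun ω i => τ i ω) (fun ω i => Δ i ω) P

/-- The arrival times; index `i` is the `(i + 1)`-st arrival `τ 0 + ⋯ + τ i`. -/
def arrival (τ : ℕ → Ω → ℝ) (i : ℕ) (ω : Ω) : ℝ :=
  ∑ j ∈ Finset.range (i + 1), τ j ω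

/-- The sum of the first `k` terms of the shot noise series with kernel `h`. -/
def partialSum (τ : ℕ → Ω → ℝ) (Δ : ℕ → Ω → EuclideanSpace ℝ (Fin d))
    (h : ℝ × EuclideanSpace ℝ (Fin d) → ℝ) (ω : Ω) (k : ℕ) : ℝ :=
  ∑ i ∈ Finset.range k, h (arrival τ i ω, Δ i ω)

/-- The shot noise series, as the limit of its partial sums. -/
def series (τ : ℕ → Ω → ℝ) (Δ : ℕ → Ω → EuclideanSpace ℝ (Fin d))
    (h : ℝ × EuclideanSpace ℝ (Fin d) → ℝ) (ω : Ω) : ℝ :=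
  limUnder atTop (partialSum τ Δ h ω)

end ShotNoise

end

noncomputable section

namespace ShotNoise

/-! ### Total variation -/

/-! Condition on the arrival time `s` of index `p` and on everything from it onward. The `p` earlier
arrivals are then, up to order, independent and uniform on `[0, s]`, with independent marks. Hence
the law of the series is a mixture over `ω`: the `p`-fold convolution power of `(λ_[0,s] ⊗ σ) h⁻¹`,
divided by its mass `s ^ p` and translated by the remainder `R` of the series after `p` terms
(`IsInput.map_series_eq`, `convPow_imageMeasure_eq`).

The laws are compared under the integral over `ω`. For fixed `s`, convergence of the convolution
powers replaces `hs n` by `h` uniformly over Borel sets; the limiting power has a density,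
translations are continuous in `L¹`, and so the remainder of `hs n` may be replaced by `R`
(`tendsto_measureReal_uniformSum_sub`). Almost sure convergence of the remainders along
subsequences, that is, convergence in probability, is enough for dominated convergence.

For convergence in probability, the difference of the two series is the series of the kernel `hs n -
h`. Truncated at level `1` and compensated by `α` times the accumulated mean, its partial sums form
a martingale with second moments at most `α * truncSq`; some value above `1` occurs with probability
at most the same bound (`IsInput.exists_limit_compSum`, `IsInput.measure_limit_sub_drift_le`). The
same martingale gives almost sure convergence of each series. There remains the drift of `hs n - h`.
Truncation is not additive, but its defect tends to `0` in `L¹` if `{|h| = 1}` has zero intensity,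
and it has: an atom of the image measure would produce an atom of its convolution power
(`intensity_abs_eq_one`).

The mixture formula is proved with characteristic functions, which are insensitive to the order of
the arrivals. If `φ` is the primitive of `q`, then `φ ^ (p + 1) = (p + 1) ∫ φ ^ p q`, so averaging
out arrivals one at a time produces `α ^ p / p!` times `φ ^ p`
(`IsInput.integral_character_mul_arrival`). Comparison with frequency `0`, where `φ s = s`, leaves
the conditional characteristic function `(φ s / s) ^ p`. -/

lemma abs_measureReal_sub_le_tvNorm (μ ν : Measure ℝ) [IsFiniteMeasure μ] [IsFiniteMeasure ν]
    {A : Set ℝ} (hA : MeasurableSet A) :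
    ENNReal.ofReal |μ.real A - ν.real A| ≤ tvNorm μ ν := by
  have h := (μ.toSignedMeasure - ν.toSignedMeasure).enorm_le_totalVariation A
  rw [Measure.toSignedMeasure_sub_apply hA, Real.enorm_eq_ofReal_abs] at h
  exact h.trans (measure_mono (Set.subset_univ _))

/-- The total variation norm is attained on a Hahn decomposition. -/
lemma exists_tvNorm_eq (μ ν : Measure ℝ) [IsFiniteMeasure μ] [IsFiniteMeasure ν] :
    ∃ A : Set ℝ, MeasurableSet A ∧ tvNorm μ ν =
      ENNReal.ofReal |μ.real A - ν.real A| + ENNReal.ofReal |μ.real Aᶜ - ν.real Aᶜ| := by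
  obtain ⟨A, hA, hpos, hneg, hp, hn⟩ :=
    (μ.toSignedMeasure - ν.toSignedMeasure).toJordanDecomposition_spec
  refine ⟨A, hA, ?_⟩
  rw [tvNorm, SignedMeasure.totalVariation, Measure.add_apply, hp, hn,
    SignedMeasure.toMeasureOfZeroLE_apply _ hpos hA MeasurableSet.univ,
    SignedMeasure.toMeasureOfLEZero_apply _ hneg hA.compl MeasurableSet.univ]
  have h1 := VectorMeasure.nonneg_of_zero_le_restrict _ hpos
  have h2 := VectorMeasure.nonpos_of_restrict_le_zero _ hneg
  rw [Measure.toSignedMeasure_sub_apply hA] at h1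
  rw [Measure.toSignedMeasure_sub_apply hA.compl] at h2
  simp only [Set.inter_univ, Measure.toSignedMeasure_sub_apply hA,
    Measure.toSignedMeasure_sub_apply hA.compl]
  rw [abs_of_nonneg h1, abs_of_nonpos h2]
  congr 1
  · exact (ENNReal.ofReal_eq_coe_nnreal h1).symm
  · exact (ENNReal.ofReal_eq_coe_nnreal (neg_nonneg.2 h2)).symm

lemma TendstoInVariation.tendsto_measureReal_sub {μs : ℕ → Measure ℝ} {μ : Measure ℝ}
    [∀ n, IsFiniteMeasure (μs n)] [IsFiniteMeasure μ] (h : TendstoInVariation μs μ)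
    {A : ℕ → Set ℝ} (hA : ∀ n, MeasurableSet (A n)) :
    Tendsto (fun n => (μs n).real (A n) - μ.real (A n)) atTop (𝓝 0) := by
  rw [tendsto_zero_iff_abs_tendsto_zero]
  have h1 : Tendsto (fun n => ENNReal.ofReal |(μs n).real (A n) - μ.real (A n)|) atTop (𝓝 0) :=
    tendsto_of_tendsto_of_tendsto_of_le_of_le tendsto_const_nhds h (fun _ => zero_le)
      (fun n => abs_measureReal_sub_le_tvNorm _ _ (hA n))
  have h2 := (ENNReal.tendsto_toReal ENNReal.zero_ne_top).comp h1
  refine (by simpa using h2 : Tendsto _ _ _).congr fun n => ?_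
  simp

/-- A Hahn set for each index turns uniformity over sets into a statement about one sequence of
sets. In this form the subsequence principle and dominated convergence become available. -/
lemma tendstoInVariation_of_forall_measurableSet {μs : ℕ → Measure ℝ} {μ : Measure ℝ}
    [∀ n, IsFiniteMeasure (μs n)] [IsFiniteMeasure μ]
    (h : ∀ A : ℕ → Set ℝ, (∀ n, MeasurableSet (A n)) →
      Tendsto (fun n => (μs n).real (A n) - μ.real (A n)) atTop (𝓝 0)) :
    TendstoInVariation μs μ := by
  choose A hA hAeq using fun n => exists_tvNorm_eq (μs n) μ
  have key : ∀ B : ℕ → Set ℝ, (∀ n, MeasurableSet (B n)) →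
      Tendsto (fun n => ENNReal.ofReal |(μs n).real (B n) - μ.real (B n)|) atTop (𝓝 0) := by
    intro B hB
    have := ENNReal.tendsto_ofReal (h B hB).abs
    simpa using this
  have := (key A hA).add (key (fun n => (A n)ᶜ) fun n => (hA n).compl)
  rw [add_zero] at this
  exact this.congr fun n => (hAeq n).symm

/-! ### Translates of absolutely continuous measures -/

/-- Continuity of translation in `L¹`, as an instance of continuity of composition with
measure-preserving maps that vary continuously in the compact-open topology. -/
lemma tendsto_integral_abs_translate_sub {f : ℝ → ℝ} (hf : Integrable f) {r : ℕ → ℝ} {r₀ : ℝ}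
    (hr : Tendsto r atTop (𝓝 r₀)) :
    Tendsto (fun n => ∫ y, |f (y - r n) - f (y - r₀)|) atTop (𝓝 0) := by
  let F : Lp ℝ 1 (volume : Measure ℝ) := hf.toL1 f
  let g : ℝ → C(ℝ, ℝ) := fun s => ⟨fun y => y - s, by fun_prop⟩
  have hg : Continuous g := by
    apply ContinuousMap.continuous_of_continuous_uncurry
    simp only [g, Function.uncurry_def, ContinuousMap.coe_mk]
    fun_prop
  have hgm : ∀ s, MeasurePreserving (g s) volume volume := fun s =>
    measurePreserving_sub_right volume s
  have h1 : Tendsto (fun n => Lp.compMeasurePreserving (g (r n)) (hgm (r n)) F) atTop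
      (𝓝 (Lp.compMeasurePreserving (g r₀) (hgm r₀) F)) :=
    Tendsto.compMeasurePreservingLp tendsto_const_nhds ((hg.tendsto r₀).comp hr) _ _ (by simp)
  rw [tendsto_iff_norm_sub_tendsto_zero] at h1
  refine h1.congr fun n => ?_
  rw [L1.norm_eq_integral_norm]
  refine integral_congr_ae ?_
  have hF : ∀ s, Lp.compMeasurePreserving (g s) (hgm s) F =ᵐ[volume] fun y => f (y - s) := by
    intro s
    refine (Lp.coeFn_compMeasurePreserving F (hgm s)).trans ?_
    exact (hgm s).quasiMeasurePreserving.ae_eq_comp hf.coeFn_toL1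
  filter_upwards [Lp.coeFn_sub (Lp.compMeasurePreserving (g (r n)) (hgm (r n)) F)
    (Lp.compMeasurePreserving (g r₀) (hgm r₀) F), hF (r n), hF r₀] with y h2 h3 h4
  rw [h2, Pi.sub_apply, h3, h4, Real.norm_eq_abs]

/-- The error is at most the `L¹` distance of two translated densities. This bound does not see the
set, so the set may vary with `n`. -/
lemma tendsto_measureReal_translate_sub {κ : Measure ℝ} [IsFiniteMeasure κ] (hκ : κ ≪ volume)
    {r : ℕ → ℝ} {r₀ : ℝ} (hr : Tendsto r atTop (𝓝 r₀)) {A : ℕ → Set ℝ}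
    (hA : ∀ n, MeasurableSet (A n)) :
    Tendsto (fun n => κ.real ((fun y => y + r n) ⁻¹' A n) - κ.real ((fun y => y + r₀) ⁻¹' A n))
      atTop (𝓝 0) := by
  set f : ℝ → ℝ := fun y => (κ.rnDeriv volume y).toReal with hf
  have hfi : Integrable f := Measure.integrable_toReal_rnDeriv
  have key : ∀ s (B : Set ℝ), MeasurableSet B →
      κ.real ((fun y => y + s) ⁻¹' B) = ∫ y in B, f (y - s) := by
    intro s B hB
    rw [← Measure.setIntegral_toReal_rnDeriv hκ,
      ← (measurePreserving_add_right volume s).setIntegral_preimage_emb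
        (measurableEmbedding_addRight s) (fun y => f (y - s))]
    simp [hf]
  rw [tendsto_zero_iff_abs_tendsto_zero]
  refine squeeze_zero (fun _ => abs_nonneg _) (fun n => ?_)
    (tendsto_integral_abs_translate_sub hfi hr)
  have hi : ∀ s, Integrable (fun y => f (y - s)) := fun s => hfi.comp_sub_right s
  simp only [Function.comp, key _ _ (hA n)]
  rw [← integral_sub (hi _).integrableOn (hi _).integrableOn]
  refine (abs_integral_le_integral_abs).trans ?_
  exact setIntegral_le_integral ((hi _).sub (hi _)).abs (ae_of_all _ fun _ => abs_nonneg _)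

/-! ### Convolution powers -/

/-- The image of the intensity on the whole half-line has infinite mass and need not be σ-finite, so
s-finiteness is the right generality. -/
instance convPow_sFinite (μ : Measure ℝ) [SFinite μ] (p : ℕ) : SFinite (convPow μ p) := by
  induction p with
  | zero => unfold convPow; infer_instance
  | succ p ih => unfold convPow; infer_instance

lemma convPow_mono {μ ν : Measure ℝ} [SFinite μ] [SFinite ν] (h : μ ≤ ν) (p : ℕ) :
    convPow μ p ≤ convPow ν p := by
  induction p with
  | zero => exact le_rfl
  | succ p ih =>
    simp only [convPow, Measure.conv]
    exact Measure.map_mono (Measure.prod_mono ih h) (by fun_prop)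

lemma pow_singleton_le_convPow (μ : Measure ℝ) [SFinite μ] (a : ℝ) (p : ℕ) :
    μ {a} ^ p ≤ convPow μ p {p * a} := by
  induction p with
  | zero => simp [convPow]
  | succ p ih =>
    rw [convPow, Measure.conv, Measure.map_apply (by fun_prop) (measurableSet_singleton _),
      pow_succ]
    calc μ {a} ^ p * μ {a} ≤ convPow μ p {p * a} * μ {a} := by gcongr
      _ = (convPow μ p).prod μ ({(p : ℝ) * a} ×ˢ {a}) := (Measure.prod_prod _ _).symm
      _ ≤ _ := by
        apply measure_mono
        rintro ⟨x, y⟩ ⟨hx, hy⟩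
        simp only [Set.mem_singleton_iff] at hx hy
        simp only [Set.mem_preimage, Set.mem_singleton_iff, hx, hy]
        push_cast; ring

/-- An atom of mass `m` at `a` forces mass at least `m ^ p` at `p * a` in the convolution power. -/
lemma singleton_eq_zero_of_convPow_absolutelyContinuous {μ : Measure ℝ} [SFinite μ] {p : ℕ}
    (h : convPow μ p ≪ volume) (a : ℝ) : μ {a} = 0 := by
  have h1 := pow_singleton_le_convPow μ a p
  rw [h (measure_singleton _), nonpos_iff_eq_zero] at h1
  exact eq_zero_of_pow_eq_zero h1

lemma charFun_convPow (μ : Measure ℝ) [IsFiniteMeasure μ] (p : ℕ) (ξ : ℝ) :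
    charFun (convPow μ p) ξ = charFun μ ξ ^ p := by
  induction p with
  | zero => simp [convPow]
  | succ p ih => rw [convPow, charFun_conv, ih, pow_succ]

/-! ### Powers of an indefinite integral -/

/-- Integration by parts for merely integrable functions: the square is cut along its diagonal and
Fubini is applied on each half. -/
lemma setIntegral_mul_setIntegral {𝕜 : Type*} [RCLike 𝕜] {F f : ℝ → 𝕜} {s : ℝ}
    (hF : IntegrableOn F (Set.Ioc 0 s)) (hf : IntegrableOn f (Set.Ioc 0 s)) :
    (∫ u in Set.Ioc 0 s, F u) * (∫ u in Set.Ioc 0 s, f u) =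
      (∫ u in Set.Ioc 0 s, (∫ v in Set.Ioc 0 u, f v) * F u) +
        ∫ u in Set.Ioc 0 s, (∫ v in Set.Ioc 0 u, F v) * f u := by
  set μ : Measure ℝ := volume.restrict (Set.Ioc 0 s) with hμ
  have hmeas : MeasurableSet {z : ℝ × ℝ | z.2 ≤ z.1} :=
    measurableSet_le measurable_snd measurable_fst
  have hprod : Integrable (fun z : ℝ × ℝ => F z.1 * f z.2) (μ.prod μ) := hF.mul_prod hf
  have hsub : ∀ u ∈ Set.Ioc 0 s, ∀ g : ℝ → 𝕜,
      ∫ v, Set.indicator (Set.Iic u) g v ∂μ = ∫ v in Set.Ioc 0 u, g v := by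
    intro u hu g
    rw [integral_indicator measurableSet_Iic, hμ, Measure.restrict_restrict measurableSet_Iic]
    congr 2
    ext v; simp only [Set.mem_inter_iff, Set.mem_Iic, Set.mem_Ioc] at *
    constructor
    · rintro ⟨a, b, c⟩; exact ⟨b, a⟩
    · rintro ⟨a, b⟩; exact ⟨b, a, b.trans hu.2⟩
  -- The diagonal belongs to the first half, so the other half has a strict inequality; the endpoint
  -- is null.
  have hsub' : ∀ u ∈ Set.Ioc 0 s, ∀ g : ℝ → 𝕜,
      ∫ v, Set.indicator (Set.Iio u) g v ∂μ = ∫ v in Set.Ioc 0 u, g v := by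
    intro u hu g
    rw [integral_indicator measurableSet_Iio, hμ, Measure.restrict_restrict measurableSet_Iio,
      integral_Ioc_eq_integral_Ioo]
    congr 2
    ext v; simp only [Set.mem_inter_iff, Set.mem_Iio, Set.mem_Ioc, Set.mem_Ioo] at *
    constructor
    · rintro ⟨a, b, c⟩; exact ⟨b, a⟩
    · rintro ⟨a, b⟩; exact ⟨b, a, b.le.trans hu.2⟩
  rw [← integral_prod_mul, ← integral_add_compl hmeas hprod]
  congr 1
  · rw [← integral_indicator hmeas, integral_prod _ (hprod.indicator hmeas)]
    refine setIntegral_congr_fun measurableSet_Ioc fun u hu => ?_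
    rw [mul_comm, ← hsub u hu f, ← integral_const_mul]
    refine integral_congr_ae (ae_of_all _ fun v => ?_)
    by_cases h : v ≤ u <;> simp [Set.indicator, h]
  · rw [← integral_indicator hmeas.compl, integral_prod_symm _ (hprod.indicator hmeas.compl)]
    refine setIntegral_congr_fun measurableSet_Ioc fun v hv => ?_
    rw [← hsub' v hv F, ← integral_mul_const]
    refine integral_congr_ae (ae_of_all _ fun u => ?_)
    by_cases h : u < v <;> simp [Set.indicator, h]

lemma stronglyMeasurable_setIntegral_Ioc {𝕜 : Type*} [RCLike 𝕜] {f : ℝ → 𝕜}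
    (hf : StronglyMeasurable f) :
    StronglyMeasurable (fun s => ∫ u in Set.Ioc 0 s, f u) := by
  have h : (fun s => ∫ u in Set.Ioc 0 s, f u) =
      fun s => ∫ u, Set.indicator {z : ℝ × ℝ | 0 < z.2 ∧ z.2 ≤ z.1} (fun z => f z.2) (s, u) := by
    funext s
    rw [← integral_indicator measurableSet_Ioc]
    rfl
  rw [h]
  refine StronglyMeasurable.integral_prod_right' (f := Set.indicator _ _) ?_
  refine (hf.comp_measurable measurable_snd).indicator ?_
  exact (measurableSet_lt measurable_const measurable_snd).inter
    (measurableSet_le measurable_snd measurable_fst)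

lemma norm_setIntegral_Ioc_le {𝕜 : Type*} [RCLike 𝕜] {f : ℝ → 𝕜} {C : ℝ}
    (hC : ∀ u, ‖f u‖ ≤ C) (s : ℝ) : ‖∫ u in Set.Ioc 0 s, f u‖ ≤ C * |s| := by
  have h := norm_setIntegral_le_of_norm_le_const (μ := volume) (s := Set.Ioc 0 s) (f := f) (C := C)
    (by simp) (fun x _ => hC x)
  refine h.trans (mul_le_mul_of_nonneg_left ?_ ((norm_nonneg _).trans (hC 0)))
  simp only [measureReal_def, Real.volume_Ioc, sub_zero]
  rcases le_total 0 s with hs | hs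
  · rw [ENNReal.toReal_ofReal hs, abs_of_nonneg hs]
  · simp [ENNReal.ofReal_of_nonpos hs]

/-- Formally the chain rule for a power of a primitive. As `f` is only measurable, the primitive is
not differentiated; induction with the product formula takes the place of the derivative. -/
lemma setIntegral_Ioc_pow_succ {𝕜 : Type*} [RCLike 𝕜] {f : ℝ → 𝕜} (hf : StronglyMeasurable f)
    {C : ℝ} (hC : ∀ u, ‖f u‖ ≤ C) (p : ℕ) (s : ℝ) :
    (∫ u in Set.Ioc 0 s, f u) ^ (p + 1) =
      (p + 1) * ∫ u in Set.Ioc 0 s, (∫ v in Set.Ioc 0 u, f v) ^ p * f u := by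
  induction p generalizing s with
  | zero => simp
  | succ p ih =>
    set φ : ℝ → 𝕜 := fun s => ∫ u in Set.Ioc 0 s, f u with hφ
    have hφm : StronglyMeasurable φ := stronglyMeasurable_setIntegral_Ioc hf
    have hC0 : 0 ≤ C := (norm_nonneg _).trans (hC 0)
    have hfi : IntegrableOn f (Set.Ioc 0 s) :=
      Measure.integrableOn_of_bounded (M := C) (by simp) hf.aestronglyMeasurable
        (ae_of_all _ hC)
    have hFi : IntegrableOn (fun u => φ u ^ p * f u) (Set.Ioc 0 s) := by
      refine Measure.integrableOn_of_bounded (M := (C * |s|) ^ p * C) (by simp)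
        ((hφm.pow p).mul hf).aestronglyMeasurable ?_
      filter_upwards [ae_restrict_mem measurableSet_Ioc] with u hu
      rw [norm_mul, norm_pow]
      gcongr
      · refine (norm_setIntegral_Ioc_le hC u).trans ?_
        gcongr
        exacts [hu.1.le, hu.2]
      · exact hC u
    -- After multiplication by `p + 1` the left side is `φ ^ (p + 2)`. On the right, both terms are
    -- multiples of `∫ φ ^ (p + 1) f`, with weights `p + 1` and `1`.
    have key := setIntegral_mul_setIntegral hFi hfi
    have h1 : ∀ u, ((p : 𝕜) + 1) * ∫ v in Set.Ioc 0 u, φ v ^ p * f v = φ u ^ (p + 1) :=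
      fun u => (ih u).symm
    have h2 : (p + 1 : 𝕜) * ∫ u in Set.Ioc 0 s, (∫ v in Set.Ioc 0 u, φ v ^ p * f v) * f u =
        ∫ u in Set.Ioc 0 s, φ u ^ (p + 1) * f u := by
      rw [← integral_const_mul]
      congr 1; funext u
      rw [← mul_assoc, h1]
    have h3 : ∫ u in Set.Ioc 0 s, (∫ v in Set.Ioc 0 u, f v) * (φ u ^ p * f u) =
        ∫ u in Set.Ioc 0 s, φ u ^ (p + 1) * f u := by
      congr 1; funext u
      change φ u * (φ u ^ p * f u) = _
      ring
    rw [h3] at key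
    rw [pow_succ, ← h1, mul_assoc, key, mul_add, h2]
    push_cast
    ring

/-! ### The exponential distribution -/

lemma expMeasure_eq {α : ℝ} : expMeasure α =
    (volume.restrict (Set.Ioi 0)).withDensity
      (fun u => ENNReal.ofReal (α * Real.exp (-(α * u)))) := by
  rw [expMeasure, gammaMeasure, ← withDensity_indicator measurableSet_Ioi]
  refine withDensity_congr_ae ?_
  filter_upwards [compl_mem_ae_iff.2 (measure_singleton (0 : ℝ))] with u hu
  have h : gammaPDF 1 α u = exponentialPDF α u := rfl
  rw [h]
  rcases lt_or_gt_of_ne (show u ≠ 0 from hu) with h0 | h0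
  · simp [Set.indicator, h0.not_gt, exponentialPDF_of_neg h0]
  · simp [Set.indicator, h0, exponentialPDF_of_nonneg h0.le]

lemma lintegral_expMeasure {α : ℝ} {f : ℝ → ENNReal} (hf : Measurable f) :
    ∫⁻ u, f u ∂expMeasure α =
      ∫⁻ u in Set.Ioi 0, ENNReal.ofReal (α * Real.exp (-(α * u))) * f u := by
  rw [expMeasure_eq, lintegral_withDensity_eq_lintegral_mul _ (by fun_prop) hf]
  rfl

lemma expMeasure_apply {α : ℝ} {D : Set ℝ} (hD : MeasurableSet D) :
    expMeasure α D =
      ∫⁻ u in Set.Ioi 0, ENNReal.ofReal (α * Real.exp (-(α * u))) * D.indicator 1 u := by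
  rw [← lintegral_expMeasure (measurable_one.indicator hD), lintegral_indicator_one hD]

lemma expMeasure_Iic {α : ℝ} (hα : 0 < α) {v : ℝ} (hv : 0 ≤ v) :
    expMeasure α (Set.Iic v) = ENNReal.ofReal (1 - Real.exp (-(α * v))) := by
  have := isProbabilityMeasure_expMeasure hα
  have h := cdf_expMeasure_eq hα v
  rw [cdf_eq_real, if_pos hv] at h
  rw [← h, measureReal_def, ENNReal.ofReal_toReal (measure_ne_top _ _)]

lemma ae_expMeasure_pos {α : ℝ} : ∀ᵐ u ∂expMeasure α, 0 < u := by
  rw [expMeasure_eq]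
  exact (withDensity_absolutelyContinuous _ _).ae_le (ae_restrict_mem measurableSet_Ioi)

/-- The renewal identity for the intensity of a Poisson process, in integrated form. -/
lemma lintegral_expMeasure_add_lintegral_translate {α : ℝ} (hα : 0 < α) {F : ℝ → ENNReal}
    (hF : Measurable F) :
    ∫⁻ u, F u ∂expMeasure α +
      ENNReal.ofReal α * ∫⁻ t in Set.Ioi 0, ∫⁻ u, F (t + u) ∂expMeasure α =
      ENNReal.ofReal α * ∫⁻ t in Set.Ioi 0, F t := by
  have := isProbabilityMeasure_expMeasure hα
  -- By a shift and Fubini, `F v` receives the weight of `{u < v}`, which is `1 - exp (-α v)`.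
  -- Multiplied by `α` and added to the exponential density, this gives the constant `α`.
  have h1 : ∫⁻ t in Set.Ioi 0, ∫⁻ u, F (t + u) ∂expMeasure α =
      ∫⁻ v in Set.Ioi 0, expMeasure α (Set.Iio v) * F v := by
    rw [lintegral_lintegral_swap (by fun_prop)]
    have : ∀ᵐ u ∂expMeasure α, ∫⁻ t in Set.Ioi 0, F (t + u) =
        ∫⁻ v in Set.Ioi 0, Set.indicator {z : ℝ × ℝ | z.1 < z.2} (fun z => F z.2) (u, v) := by
      filter_upwards [ae_expMeasure_pos] with u hu
      have h2 : (fun v => Set.indicator {z : ℝ × ℝ | z.1 < z.2} (fun z => F z.2) (u, v)) =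
          Set.indicator (Set.Ioi u) F := by
        funext v; by_cases h : u < v <;> simp [Set.indicator, h]
      rw [h2, lintegral_indicator measurableSet_Ioi, Measure.restrict_restrict measurableSet_Ioi,
        Set.inter_eq_self_of_subset_left (Set.Ioi_subset_Ioi hu.le),
        ← (measurePreserving_add_right volume u).setLIntegral_comp_preimage_emb
          (measurableEmbedding_addRight u) F]
      simp
    rw [lintegral_congr_ae this, lintegral_lintegral_swap]
    · refine lintegral_congr fun v => ?_
      have h2 : (fun u => Set.indicator {z : ℝ × ℝ | z.1 < z.2} (fun z => F z.2) (u, v)) =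
          Set.indicator (Set.Iio v) (fun _ => F v) := by
        funext u; by_cases h : u < v <;> simp [Set.indicator, h]
      rw [h2, lintegral_indicator measurableSet_Iio, setLIntegral_const, mul_comm]
    · exact ((hF.comp measurable_snd).indicator
        (measurableSet_lt measurable_fst measurable_snd)).aemeasurable
  have hm : Measurable fun v => expMeasure α (Set.Iio v) :=
    (Monotone.measurable fun a b h => measure_mono (Set.Iio_subset_Iio h))
  rw [h1, lintegral_expMeasure hF, ← lintegral_const_mul _ (by exact hm.mul hF),
    ← lintegral_const_mul _ hF, ← lintegral_add_left (by fun_prop)]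
  refine setLIntegral_congr_fun measurableSet_Ioi fun v hv => ?_
  have hv0 : (0 : ℝ) < v := hv
  have h3 : expMeasure α (Set.Iio v) = ENNReal.ofReal (1 - Real.exp (-(α * v))) := by
    rw [← expMeasure_Iic hα hv0.le]
    refine measure_congr (Iio_ae_eq_Iic' ?_)
    rw [expMeasure_eq]
    exact withDensity_absolutelyContinuous _ _ (by simp)
  have h4 : Real.exp (-(α * v)) ≤ 1 := Real.exp_le_one_iff.2 (by nlinarith)
  rw [h3, ← mul_assoc, ← add_mul, ← ENNReal.ofReal_mul hα.le,
    ← ENNReal.ofReal_add (by positivity) (mul_nonneg hα.le (by linarith))]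
  congr 2; ring

/-- Two successive arrival times of a Poisson process: given the second, the first is uniform. -/
lemma map_expMeasure_prod {α : ℝ} (hα : 0 < α) :
    ((expMeasure α).prod (expMeasure α)).map (fun z : ℝ × ℝ => (z.1, z.1 + z.2)) =
      (((ENNReal.ofReal α) • volume.restrict (Set.Ioi 0)).prod (expMeasure α)).restrict
        {z | z.1 < z.2} := by
  have := isProbabilityMeasure_expMeasure hα
  have hlt : MeasurableSet {z : ℝ × ℝ | z.1 < z.2} := measurableSet_lt measurable_fst measurable_snd
  ext B hB
  have hB1 : Measurable (Set.indicator B (1 : ℝ × ℝ → ENNReal)) := measurable_one.indicator hB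
  rw [Measure.map_apply (by fun_prop) hB, Measure.restrict_apply hB,
    Measure.prod_apply (hB.preimage (by fun_prop)), Measure.prod_apply (hB.inter hlt),
    lintegral_smul_measure, lintegral_expMeasure, smul_eq_mul, ← lintegral_const_mul]
  rotate_left
  · exact measurable_measure_prodMk_left (hB.inter hlt)
  · exact measurable_measure_prodMk_left (hB.preimage (by fun_prop))
  refine setLIntegral_congr_fun measurableSet_Ioi fun s hs => ?_
  have hs0 : (0 : ℝ) < s := hs
  have e1 : expMeasure α (Prod.mk s ⁻¹' ((fun z : ℝ × ℝ => (z.1, z.1 + z.2)) ⁻¹' B)) =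
      ∫⁻ u in Set.Ioi 0, ENNReal.ofReal (α * Real.exp (-(α * u))) * B.indicator 1 (s, s + u) := by
    exact expMeasure_apply ((hB.preimage (by fun_prop)).preimage (by fun_prop))
  have e2 : expMeasure α (Prod.mk s ⁻¹' (B ∩ {z | z.1 < z.2})) =
      ∫⁻ u in Set.Ioi 0, ENNReal.ofReal (α * Real.exp (-(α * u))) *
        (B ∩ {z | z.1 < z.2}).indicator 1 (s, u) := by
    exact expMeasure_apply ((hB.inter hlt).preimage (by fun_prop))
  have e3 : ∫⁻ u in Set.Ioi 0, ENNReal.ofReal (α * Real.exp (-(α * u))) *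
        (B ∩ {z | z.1 < z.2}).indicator 1 (s, u) =
      ∫⁻ u in Set.Ioi s, ENNReal.ofReal (α * Real.exp (-(α * u))) * B.indicator 1 (s, u) := by
    rw [← lintegral_indicator measurableSet_Ioi, ← lintegral_indicator measurableSet_Ioi]
    refine lintegral_congr fun u => ?_
    by_cases h : s < u
    · have h' : (s, u) ∈ B ∩ {z : ℝ × ℝ | z.1 < z.2} ↔ (s, u) ∈ B := by simp [h]
      simp [Set.indicator, h, hs0.trans h]
      split_ifs <;> tauto
    · simp [Set.indicator, h]
  -- After the shift, the identity is `α e^{-α s} * α e^{-α u} = α * α e^{-α (s + u)}`: the joint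
  -- density depends only on the second arrival time.
  have e4 : ∫⁻ u in Set.Ioi s, ENNReal.ofReal (α * Real.exp (-(α * u))) * B.indicator 1 (s, u) =
      ∫⁻ u in Set.Ioi 0, ENNReal.ofReal (α * Real.exp (-(α * (s + u)))) *
        B.indicator 1 (s, s + u) := by
    rw [← (measurePreserving_add_left volume s).setLIntegral_comp_preimage_emb
          (measurableEmbedding_addLeft s)]
    simp
  rw [e1, e2, e3, e4, ← lintegral_const_mul _ (by
      exact (by fun_prop : Measurable fun u : ℝ => ENNReal.ofReal (α * Real.exp (-(α * u)))).mul
        (hB1.comp (by fun_prop))),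
    ← lintegral_const_mul _ (by
      exact (by fun_prop : Measurable fun u : ℝ =>
        ENNReal.ofReal (α * Real.exp (-(α * (s + u))))).mul (hB1.comp (by fun_prop)))]
  refine lintegral_congr fun u => ?_
  rw [← mul_assoc, ← mul_assoc, ← ENNReal.ofReal_mul (by positivity), ← ENNReal.ofReal_mul hα.le]
  congr 2
  rw [mul_add, neg_add, Real.exp_add]; ring

/-- The law of two successive arrivals tested on a product; it drives the inductions over arrivals.
`F` is only required to be integrable because it will be a power of a primitive, which is unbounded.
-/
lemma integral_mul_integral_translate_expMeasure {𝕜 : Type*} [RCLike 𝕜] {α : ℝ} (hα : 0 < α)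
    {F G : ℝ → 𝕜} (hF : Integrable F (expMeasure α)) (hFm : StronglyMeasurable F)
    (hG : StronglyMeasurable G) {C : ℝ} (hC : ∀ u, ‖G u‖ ≤ C) :
    ∫ s, F s * ∫ u, G (s + u) ∂expMeasure α ∂expMeasure α =
      ∫ v, (α * ∫ s in Set.Ioc 0 v, F s) * G v ∂expMeasure α := by
  have := isProbabilityMeasure_expMeasure hα
  have hlt : MeasurableSet {z : ℝ × ℝ | z.1 < z.2} := measurableSet_lt measurable_fst measurable_snd
  have hFG : StronglyMeasurable fun z : ℝ × ℝ => F z.1 * G z.2 :=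
    (hFm.comp_measurable measurable_fst).mul (hG.comp_measurable measurable_snd)
  have hint : Integrable (fun z : ℝ × ℝ => F z.1 * G (z.1 + z.2))
      ((expMeasure α).prod (expMeasure α)) := by
    refine (hF.comp_fst (expMeasure α)).mul_bdd (c := C) ?_ (ae_of_all _ fun z => hC _)
    exact (hG.comp_measurable (by fun_prop)).aestronglyMeasurable
  have hmap : Integrable (fun z : ℝ × ℝ => F z.1 * G z.2)
      ((((ENNReal.ofReal α) • volume.restrict (Set.Ioi 0)).prod (expMeasure α)).restrict
        {z | z.1 < z.2}) := by
    rw [← map_expMeasure_prod hα, integrable_map_measure hFG.aestronglyMeasurable (by fun_prop)]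
    exact hint
  have h1 : ∫ s, F s * ∫ u, G (s + u) ∂expMeasure α ∂expMeasure α =
      ∫ z, F z.1 * G (z.1 + z.2) ∂((expMeasure α).prod (expMeasure α)) := by
    rw [integral_prod _ hint]
    simp_rw [integral_const_mul]
  have h2 : ∫ z, F z.1 * G (z.1 + z.2) ∂((expMeasure α).prod (expMeasure α)) =
      ∫ z, F z.1 * G z.2 ∂(((expMeasure α).prod (expMeasure α)).map
        (fun z : ℝ × ℝ => (z.1, z.1 + z.2))) := by
    rw [integral_map (by fun_prop) hFG.aestronglyMeasurable]
  rw [h1, h2, map_expMeasure_prod hα, ← integral_indicator hlt, integral_prod_symm _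
    ((integrable_indicator_iff hlt).2 hmap)]
  refine integral_congr_ae ?_
  filter_upwards [ae_expMeasure_pos] with v hv
  have h3 : (fun s => Set.indicator {z : ℝ × ℝ | z.1 < z.2} (fun z => F z.1 * G z.2) (s, v)) =
      Set.indicator (Set.Iio v) (fun s => F s * G v) := by
    funext u; by_cases h : u < v <;> simp [Set.indicator, h]
  rw [h3, integral_indicator measurableSet_Iio, Measure.restrict_smul, integral_smul_measure,
    Measure.restrict_restrict measurableSet_Iio, integral_mul_const, Set.inter_comm,
    Set.Ioi_inter_Iio, ← integral_Ioc_eq_integral_Ioo, ENNReal.toReal_ofReal hα.le,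
    RCLike.real_smul_eq_coe_mul, mul_assoc]

/-! ### The marked arrivals as an i.i.d. sequence -/

section Input

variable {d : ℕ} {Ω : Type*}

/-- The pair of the `k`-th inter-arrival time and the `k`-th mark. -/
def mark (τ : ℕ → Ω → ℝ) (Δ : ℕ → Ω → EuclideanSpace ℝ (Fin d)) (k : ℕ) (ω : Ω) :
    ℝ × EuclideanSpace ℝ (Fin d) :=
  (τ k ω, Δ k ω)

/-- The time at which the `k`-th inter-arrival period starts. -/
def startTime (τ : ℕ → Ω → ℝ) (k : ℕ) (ω : Ω) : ℝ := ∑ j ∈ Finset.range k, τ j ω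

lemma arrival_eq_startTime_add (τ : ℕ → Ω → ℝ) (k : ℕ) (ω : Ω) :
    arrival τ k ω = startTime τ k ω + τ k ω := Finset.sum_range_succ _ _

lemma startTime_succ (τ : ℕ → Ω → ℝ) (k : ℕ) (ω : Ω) :
    startTime τ (k + 1) ω = arrival τ k ω := rfl

variable [mΩ : MeasurableSpace Ω] {P : Measure Ω} {α : ℝ} {σ : Measure (EuclideanSpace ℝ (Fin d))}
  {τ : ℕ → Ω → ℝ} {Δ : ℕ → Ω → EuclideanSpace ℝ (Fin d)}

namespace IsInput

lemma measurable_mark (hi : IsInput P α σ τ Δ) (k : ℕ) : Measurable (mark τ Δ k) :=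
  (hi.measurable_τ k).prodMk (hi.measurable_Δ k)

/-- Rectangles form a π-system generating the product σ-algebra. On them the independence of the two
sequences separates times from marks, and each family then factorises. -/
lemma iIndepFun_mark (hi : IsInput P α σ τ Δ) : iIndepFun (mark τ Δ) P := by
  rw [iIndepFun_iff_iIndep]
  set C : Set (Set (ℝ × EuclideanSpace ℝ (Fin d))) :=
    Set.image2 (fun s t => s ×ˢ t) {s | MeasurableSet s} {t | MeasurableSet t} with hC
  refine iIndepSets.iIndep (fun k => (hi.measurable_mark k).comap_le)
    (fun k => Set.preimage (mark τ Δ k) '' C) (fun k => ?_) (fun k => ?_) ?_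
  · exact (isPiSystem_prod : IsPiSystem C).comap _
  · rw [← MeasurableSpace.comap_generateFrom, hC, generateFrom_prod]
  · rw [iIndepSets_iff]
    intro S f hf
    have hf' : ∀ i, ∃ A B, MeasurableSet A ∧ MeasurableSet B ∧
        (i ∈ S → f i = τ i ⁻¹' A ∩ Δ i ⁻¹' B) := by
      intro i
      by_cases hiS : i ∈ S
      · obtain ⟨_, ⟨A, hA, B, hB, rfl⟩, hAB⟩ := hf i hiS
        exact ⟨A, B, hA, hB, fun _ => hAB.symm⟩
      -- Indices outside `S` play no role; the empty sets are default values.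
      · exact ⟨∅, ∅, MeasurableSet.empty, MeasurableSet.empty, fun h => absurd h hiS⟩
    choose A B hA hB hAB using hf'
    have e1 : ⋂ i ∈ S, f i = (⋂ i ∈ S, τ i ⁻¹' A i) ∩ (⋂ i ∈ S, Δ i ⁻¹' B i) := by
      rw [Set.iInter₂_congr hAB]
      ext ω
      simp only [Set.mem_iInter, Set.mem_inter_iff]
      exact ⟨fun h => ⟨fun i hi => (h i hi).1, fun i hi => (h i hi).2⟩,
        fun h i hi => ⟨h.1 i hi, h.2 i hi⟩⟩
    have e2 : P ((⋂ i ∈ S, τ i ⁻¹' A i) ∩ (⋂ i ∈ S, Δ i ⁻¹' B i)) =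
        P (⋂ i ∈ S, τ i ⁻¹' A i) * P (⋂ i ∈ S, Δ i ⁻¹' B i) := by
      have := hi.indep.measure_inter_preimage_eq_mul
        ((S : Set ℕ).pi A) ((S : Set ℕ).pi B)
        (MeasurableSet.pi S.countable_toSet fun i _ => hA i)
        (MeasurableSet.pi S.countable_toSet fun i _ => hB i)
      convert this using 2
      · congr 1 <;> (ext ω; simp)
      · congr 1; ext ω; simp
      · congr 1; ext ω; simp
    rw [e1, e2, hi.indep_τ.measure_inter_preimage_eq_mul S (fun i _ => hA i),
      hi.indep_Δ.measure_inter_preimage_eq_mul S (fun i _ => hB i), ← Finset.prod_mul_distrib]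
    refine Finset.prod_congr rfl fun i hiS => ?_
    rw [hAB i hiS]
    have h := hi.indep.comp (measurable_pi_apply i) (measurable_pi_apply i)
    exact (h.measure_inter_preimage_eq_mul (A i) (B i) (hA i) (hB i)).symm

/-- The history of the marked arrivals with index less than `k`. -/
def past (hi : IsInput P α σ τ Δ) : Filtration ℕ mΩ where
  seq k := ⨆ j ∈ Set.Iio k, MeasurableSpace.comap (mark τ Δ j) inferInstance
  mono' _ _ hkl := biSup_mono fun _ hj => lt_of_lt_of_le hj hkl
  le' _ := iSup₂_le fun j _ => (hi.measurable_mark j).comap_le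

lemma measurable_mark_past (hi : IsInput P α σ τ Δ) {j k : ℕ} (hjk : j < k) :
    Measurable[hi.past k] (mark τ Δ j) := by
  rw [measurable_iff_comap_le]
  exact le_iSup₂_of_le (f := fun j (_ : j ∈ Set.Iio k) =>
    MeasurableSpace.comap (mark τ Δ j) inferInstance) j hjk le_rfl

lemma measurable_startTime_past (hi : IsInput P α σ τ Δ) (k : ℕ) :
    Measurable[hi.past k] (startTime τ k) := by
  refine Finset.measurable_fun_sum _ fun j hj => ?_
  exact measurable_fst.comp (hi.measurable_mark_past (Finset.mem_range.1 hj))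

lemma measurable_startTime (hi : IsInput P α σ τ Δ) (k : ℕ) : Measurable (startTime τ k) :=
  (hi.measurable_startTime_past k).mono (hi.past.le k) le_rfl

lemma measurable_arrival (hi : IsInput P α σ τ Δ) (k : ℕ) : Measurable (arrival τ k) :=
  hi.measurable_startTime (k + 1)

lemma measurable_term_past (hi : IsInput P α σ τ Δ) {β : Type*} [MeasurableSpace β]
    {f : ℝ × EuclideanSpace ℝ (Fin d) → β}
    (hf : Measurable f) {j k : ℕ} (hjk : j < k) :
    Measurable[hi.past k] (fun ω => f (arrival τ j ω, Δ j ω)) := by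
  refine hf.comp (Measurable.prodMk ?_ ?_)
  · exact (hi.measurable_startTime_past (j + 1)).mono (hi.past.mono hjk) le_rfl
  · exact measurable_snd.comp (hi.measurable_mark_past hjk)

lemma measurable_term (hi : IsInput P α σ τ Δ) {β : Type*} [MeasurableSpace β]
    {f : ℝ × EuclideanSpace ℝ (Fin d) → β} (hf : Measurable f) (j : ℕ) :
    Measurable (fun ω => f (arrival τ j ω, Δ j ω)) :=
  (hi.measurable_term_past hf j.lt_succ_self).mono (hi.past.le _) le_rfl

lemma measurable_partialSum_past (hi : IsInput P α σ τ Δ) {h : ℝ × EuclideanSpace ℝ (Fin d) → ℝ}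
    (hh : Measurable h) {j k : ℕ} (hjk : j ≤ k) :
    Measurable[hi.past k] (fun ω => partialSum τ Δ h ω j) :=
  Finset.measurable_fun_sum _ fun _ hj =>
    hi.measurable_term_past hh ((Finset.mem_range.1 hj).trans_le hjk)

lemma measurable_partialSum (hi : IsInput P α σ τ Δ) {h : ℝ × EuclideanSpace ℝ (Fin d) → ℝ}
    (hh : Measurable h) (k : ℕ) : Measurable (fun ω => partialSum τ Δ h ω k) :=
  (hi.measurable_partialSum_past hh le_rfl).mono (hi.past.le k) le_rfl

lemma map_mark (hi : IsInput P α σ τ Δ) [IsFiniteMeasure P] (k : ℕ) :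
    P.map (mark τ Δ k) = (expMeasure α).prod σ := by
  have h := hi.indep.comp (measurable_pi_apply k) (measurable_pi_apply k)
  have := (indepFun_iff_map_prod_eq_prod_map_map (hi.measurable_τ k).aemeasurable
    (hi.measurable_Δ k).aemeasurable).1 h
  rw [hi.law_τ, hi.law_Δ] at this
  exact this

lemma indepFun_mark (hi : IsInput P α σ τ Δ) {β : Type*} [MeasurableSpace β] {k : ℕ} {X : Ω → β}
    (hX : Measurable[hi.past k] X) : IndepFun X (mark τ Δ k) P := by
  have h : Indep (⨆ j ∈ Set.Iio k, MeasurableSpace.comap (mark τ Δ j) inferInstance)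
      (⨆ j ∈ ({k} : Set ℕ), MeasurableSpace.comap (mark τ Δ j) inferInstance) P :=
    indep_iSup_of_disjoint (fun j => (hi.measurable_mark j).comap_le) hi.iIndepFun_mark.iIndep
      (by simp)
  rw [iSup_singleton] at h
  rw [IndepFun_iff_Indep]
  exact indep_of_indep_of_le_left h hX.comap_le

/-- The mark pair `k` is independent of its past. -/
lemma map_prodMk_mark (hi : IsInput P α σ τ Δ) [IsFiniteMeasure P] {β : Type*} [MeasurableSpace β]
    {k : ℕ} {X : Ω → β} (hX : Measurable[hi.past k] X) :
    P.map (fun ω => (X ω, mark τ Δ k ω)) = (P.map X).prod ((expMeasure α).prod σ) := by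
  rw [← hi.map_mark k]
  exact (indepFun_iff_map_prod_eq_prod_map_map
    (hX.mono (hi.past.le k) le_rfl).aemeasurable (hi.measurable_mark k).aemeasurable).1
    (hi.indepFun_mark hX)

/-- The freezing principle: a quantity known from the past is held fixed while the current
inter-arrival time and mark are integrated out. It does the work of conditional expectations here.
-/
lemma lintegral_mark [IsFiniteMeasure P] [SFinite σ] [SFinite (expMeasure α)]
    (hi : IsInput P α σ τ Δ) {β : Type*} [MeasurableSpace β]
    {k : ℕ} {X : Ω → β} (hX : Measurable[hi.past k] X)
    {f : β × ℝ × EuclideanSpace ℝ (Fin d) → ENNReal} (hf : Measurable f) :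
    ∫⁻ ω, f (X ω, τ k ω, Δ k ω) ∂P =
      ∫⁻ ω, ∫⁻ u, ∫⁻ x, f (X ω, u, x) ∂σ ∂expMeasure α ∂P := by
  have hX' : Measurable X := hX.mono (hi.past.le k) le_rfl
  have h1 : ∫⁻ ω, f (X ω, τ k ω, Δ k ω) ∂P =
      ∫⁻ z, f z ∂(P.map (fun ω => (X ω, mark τ Δ k ω))) := by
    rw [lintegral_map hf (hX'.prodMk (hi.measurable_mark k))]
    rfl
  rw [h1, hi.map_prodMk_mark hX, lintegral_prod _ hf.aemeasurable, lintegral_map _ hX']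
  · refine lintegral_congr fun ω => ?_
    rw [lintegral_prod _ (by fun_prop)]
  · exact hf.lintegral_prod_right'

lemma integral_mark [IsFiniteMeasure P] [SFinite σ] [SFinite (expMeasure α)]
    {F : Type*} [NormedAddCommGroup F] [NormedSpace ℝ F]
    (hi : IsInput P α σ τ Δ) {β : Type*} [MeasurableSpace β]
    {k : ℕ} {X : Ω → β} (hX : Measurable[hi.past k] X)
    {f : β × ℝ × EuclideanSpace ℝ (Fin d) → F} (hf : StronglyMeasurable f)
    (hint : Integrable (fun ω => f (X ω, τ k ω, Δ k ω)) P) :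
    ∫ ω, f (X ω, τ k ω, Δ k ω) ∂P =
      ∫ ω, ∫ z, f (X ω, z) ∂((expMeasure α).prod σ) ∂P := by
  have hX' : Measurable X := hX.mono (hi.past.le k) le_rfl
  have hXm : Measurable (fun ω => (X ω, mark τ Δ k ω)) := hX'.prodMk (hi.measurable_mark k)
  have h1 : ∫ ω, f (X ω, τ k ω, Δ k ω) ∂P =
      ∫ z, f z ∂(P.map (fun ω => (X ω, mark τ Δ k ω))) := by
    rw [integral_map hXm.aemeasurable hf.aestronglyMeasurable]
    rfl
  have h2 : Integrable f (P.map (fun ω => (X ω, mark τ Δ k ω))) := by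
    rw [integrable_map_measure hf.aestronglyMeasurable hXm.aemeasurable]
    exact hint
  rw [hi.map_prodMk_mark hX] at h2
  rw [h1, hi.map_prodMk_mark hX, integral_prod _ h2, integral_map hX'.aemeasurable]
  exact hf.integral_prod_right'.aestronglyMeasurable

/-! ### The intensity of the arrivals -/

/-- Averaging the last inter-arrival time of every term but the first replaces `F` by its
exponential average and lowers each index by one. The renewal identity closes the induction. -/
lemma sum_lintegral_arrival_le [IsProbabilityMeasure P] [IsProbabilityMeasure σ]
    (hi : IsInput P α σ τ Δ) (hα : 0 < α)
    {F : ℝ → ENNReal} (hF : Measurable F) (m : ℕ) :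
    ∑ k ∈ Finset.range m, ∫⁻ ω, F (arrival τ k ω) ∂P ≤
      ENNReal.ofReal α * ∫⁻ t in Set.Ioi 0, F t := by
  have := isProbabilityMeasure_expMeasure hα
  have hstep : ∀ (G : ℝ → ENNReal), Measurable G → ∀ k, ∫⁻ ω, G (arrival τ k ω) ∂P =
      ∫⁻ ω, ∫⁻ u, G (startTime τ k ω + u) ∂expMeasure α ∂P := by
    intro G hG k
    simp_rw [arrival_eq_startTime_add]
    rw [hi.lintegral_mark (hi.measurable_startTime_past k) (f := fun z => G (z.1 + z.2.1))
      (by fun_prop)]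
    simp
  induction m generalizing F with
  | zero => simp
  | succ m ih =>
    rw [Finset.sum_range_succ', ← lintegral_expMeasure_add_lintegral_translate hα hF, add_comm]
    refine add_le_add (le_of_eq ?_) ?_
    · rw [hstep F hF]; simp [startTime]
    · refine le_trans (le_of_eq ?_) (ih (F := fun t => ∫⁻ u, F (t + u) ∂expMeasure α)
        (hF.comp measurable_add).lintegral_prod_right')
      exact Finset.sum_congr rfl fun k _ => hstep F hF (k + 1)

/-- The mean number of arrivals is dominated by the intensity measure. -/
lemma tsum_lintegral_term_le [IsProbabilityMeasure P] [IsProbabilityMeasure σ]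
    (hi : IsInput P α σ τ Δ) (hα : 0 < α)
    {f : ℝ × EuclideanSpace ℝ (Fin d) → ENNReal} (hf : Measurable f) :
    ∑' k, ∫⁻ ω, f (arrival τ k ω, Δ k ω) ∂P ≤
      ENNReal.ofReal α * ∫⁻ z, f z ∂((volume.restrict (Set.Ici 0)).prod σ) := by
  have := isProbabilityMeasure_expMeasure hα
  refine ENNReal.tsum_le_of_sum_range_le fun m => ?_
  rw [lintegral_prod _ hf.aemeasurable, setLIntegral_congr Ioi_ae_eq_Ici.symm]
  refine le_trans (le_of_eq ?_) (hi.sum_lintegral_arrival_le hα hf.lintegral_prod_right' m)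
  refine Finset.sum_congr rfl fun k _ => ?_
  simp_rw [arrival_eq_startTime_add]
  rw [hi.lintegral_mark (hi.measurable_startTime_past k) (f := fun z => f (z.1 + z.2.1, z.2.2))
      (by fun_prop),
    hi.lintegral_mark (hi.measurable_startTime_past k)
      (f := fun z => ∫⁻ x, f (z.1 + z.2.1, x) ∂σ)]
  · simp
  · exact hf.lintegral_prod_right'.comp (by fun_prop : Measurable
      fun z : ℝ × ℝ × EuclideanSpace ℝ (Fin d) => z.1 + z.2.1)

lemma tsum_measure_term_le [IsProbabilityMeasure P] [IsProbabilityMeasure σ]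
    (hi : IsInput P α σ τ Δ) (hα : 0 < α)
    {B : Set (ℝ × EuclideanSpace ℝ (Fin d))} (hB : MeasurableSet B) :
    ∑' k, P {ω | (arrival τ k ω, Δ k ω) ∈ B} ≤
      ENNReal.ofReal α * ((volume.restrict (Set.Ici 0)).prod σ) B := by
  have h := hi.tsum_lintegral_term_le hα (measurable_one.indicator hB)
  rw [lintegral_indicator_one hB] at h
  refine le_trans (le_of_eq (tsum_congr fun k => ?_)) h
  have hm : MeasurableSet {ω | (arrival τ k ω, Δ k ω) ∈ B} :=
    hB.preimage (hi.measurable_term measurable_id k)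
  rw [← lintegral_indicator_one hm]
  rfl

lemma ae_interarrival_pos [IsProbabilityMeasure P] (hi : IsInput P α σ τ Δ) :
    ∀ᵐ ω ∂P, ∀ k, 0 < τ k ω := by
  rw [ae_all_iff]
  intro k
  have h : ∀ᵐ u ∂(P.map (τ k)), 0 < u := by rw [hi.law_τ]; exact ae_expMeasure_pos
  exact ae_of_ae_map (hi.measurable_τ k).aemeasurable h

/-- The expected number of arrivals in `[0, n]` is finite, so by Borel–Cantelli only finitely many
occur there. -/
lemma ae_tendsto_arrival [IsProbabilityMeasure P] [IsProbabilityMeasure σ]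
    (hi : IsInput P α σ τ Δ) (hα : 0 < α) :
    ∀ᵐ ω ∂P, Tendsto (fun k => arrival τ k ω) atTop atTop := by
  have h : ∀ n : ℕ, ∀ᵐ ω ∂P, ∀ᶠ k in atTop, ¬ (arrival τ k ω ≤ n) := by
    intro n
    have h1 := hi.tsum_measure_term_le hα (B := Set.Iic (n : ℝ) ×ˢ Set.univ)
      (measurableSet_Iic.prod MeasurableSet.univ)
    rw [Measure.prod_prod, Measure.restrict_apply measurableSet_Iic] at h1
    have h2 : ∑' k, P {ω | arrival τ k ω ≤ n} ≠ ⊤ := by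
      refine ne_top_of_le_ne_top (ENNReal.mul_ne_top ENNReal.ofReal_ne_top ?_) (by simpa using h1)
      rw [Set.inter_comm, Set.Ici_inter_Iic]
      simp
    have h3 := measure_setOfPred_frequently_eq_zero h2
    filter_upwards [measure_eq_zero_iff_ae_notMem.1 h3] with ω hω
    simpa [Filter.Frequently] using hω
  rw [← ae_all_iff] at h
  filter_upwards [h] with ω hω
  rw [tendsto_atTop]
  intro b
  obtain ⟨n, hn⟩ := exists_nat_ge b
  filter_upwards [hω n] with k hk
  linarith

end IsInput

end Input

lemma integrable_pow_expMeasure {α : ℝ} (hα : 0 < α) (n : ℕ) :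
    Integrable (fun u : ℝ => u ^ n) (expMeasure α) := by
  rw [expMeasure_eq, integrable_withDensity_iff_integrable_smul₀' (by fun_prop)
    (ae_of_all _ fun _ => ENNReal.ofReal_lt_top)]
  have h := (integrableOn_rpow_mul_exp_neg_mul_rpow (s := n) (p := 1) (b := α)
    (by have := n.cast_nonneg (α := ℝ); linarith) zero_lt_one hα).const_mul α
  refine h.congr ?_
  filter_upwards [ae_restrict_mem measurableSet_Ioi] with u hu
  have : (0 : ℝ) < u := hu
  rw [ENNReal.toReal_ofReal (by positivity), smul_eq_mul, Real.rpow_natCast, Real.rpow_one, neg_mul]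
  ring

/-! ### The compensated increments -/

section Compensated

variable {d : ℕ} {σ : Measure (EuclideanSpace ℝ (Fin d))}
  {g : ℝ × EuclideanSpace ℝ (Fin d) → ℝ}

/-- The mean of the kernel at time `t`. -/
def meanRate (σ : Measure (EuclideanSpace ℝ (Fin d))) (g : ℝ × EuclideanSpace ℝ (Fin d) → ℝ)
    (t : ℝ) : ℝ := ∫ x, g (t, x) ∂σ

/-- The mean of the kernel accumulated up to time `s`. -/
def cumMean (σ : Measure (EuclideanSpace ℝ (Fin d))) (g : ℝ × EuclideanSpace ℝ (Fin d) → ℝ)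
    (s : ℝ) : ℝ := ∫ v in (0 : ℝ)..s, meanRate σ g v

/-- The term of the series caused by an arrival at time `t + u` with mark `x`, compensated by the
mean accumulated over the period from `t` to `t + u`. -/
def compIncr (α : ℝ) (σ : Measure (EuclideanSpace ℝ (Fin d)))
    (g : ℝ × EuclideanSpace ℝ (Fin d) → ℝ) (w : ℝ × ℝ × EuclideanSpace ℝ (Fin d)) : ℝ :=
  g (w.1 + w.2.1, w.2.2) - α * (cumMean σ g (w.1 + w.2.1) - cumMean σ g w.1)

lemma stronglyMeasurable_meanRate [SFinite σ] (hg : Measurable g) :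
    StronglyMeasurable (meanRate σ g) :=
  hg.stronglyMeasurable.integral_prod_right'

lemma abs_meanRate_le [IsProbabilityMeasure σ] (hb : ∀ z, |g z| ≤ 1) (t : ℝ) :
    |meanRate σ g t| ≤ 1 := by
  have := norm_integral_le_of_norm_le_const (μ := σ) (f := fun x => g (t, x)) (C := 1)
    (ae_of_all _ fun x => hb _)
  simpa [meanRate] using this

lemma intervalIntegrable_meanRate [IsProbabilityMeasure σ] (hg : Measurable g)
    (hb : ∀ z, |g z| ≤ 1) (a b : ℝ) : IntervalIntegrable (meanRate σ g) volume a b := by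
  refine (intervalIntegrable_const (c := (1 : ℝ))).mono_fun
    (stronglyMeasurable_meanRate hg).aestronglyMeasurable ?_
  exact ae_of_all _ fun t => by simpa using abs_meanRate_le hb t

lemma continuous_cumMean [IsProbabilityMeasure σ] (hg : Measurable g) (hb : ∀ z, |g z| ≤ 1) :
    Continuous (cumMean σ g) :=
  intervalIntegral.continuous_primitive (intervalIntegrable_meanRate hg hb) 0

lemma cumMean_add_sub [IsProbabilityMeasure σ] (hg : Measurable g) (hb : ∀ z, |g z| ≤ 1)
    (t : ℝ) {u : ℝ} (hu : 0 ≤ u) :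
    cumMean σ g (t + u) - cumMean σ g t = ∫ v in Set.Ioc 0 u, meanRate σ g (t + v) := by
  rw [cumMean, cumMean, intervalIntegral.integral_interval_sub_left
    (intervalIntegrable_meanRate hg hb _ _) (intervalIntegrable_meanRate hg hb _ _),
    ← intervalIntegral.integral_of_le hu, intervalIntegral.integral_comp_add_left]
  simp

lemma measurable_compIncr [IsProbabilityMeasure σ] {α : ℝ} (hg : Measurable g)
    (hb : ∀ z, |g z| ≤ 1) : Measurable (compIncr α σ g) := by
  have h := (continuous_cumMean (σ := σ) hg hb).measurable
  unfold compIncr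
  fun_prop

section Moments

variable [IsProbabilityMeasure σ] {α : ℝ}

/-- A bounded kernel, its compensator and the mean rate, on one inter-arrival period. -/
lemma integrable_comp_add (hα : 0 < α) (hg : Measurable g) (hb : ∀ z, |g z| ≤ 1) (t : ℝ) :
    Integrable (fun z : ℝ × EuclideanSpace ℝ (Fin d) => g (t + z.1, z.2))
      ((expMeasure α).prod σ) := by
  have := isProbabilityMeasure_expMeasure hα
  exact Integrable.of_bound (C := 1) (Measurable.aestronglyMeasurable (by fun_prop))
      (ae_of_all _ fun z => hb _)

lemma setIntegral_meanRate_bound (hb : ∀ z, |g z| ≤ 1) (t u : ℝ) :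
    |∫ v in Set.Ioc 0 u, meanRate σ g (t + v)| ≤ |u| := by
  simpa using norm_setIntegral_Ioc_le (f := fun v => meanRate σ g (t + v)) (C := 1)
    (fun v => by simpa using abs_meanRate_le hb (t + v)) u

lemma integral_comp_mul (hα : 0 < α) (hg : Measurable g) (hb : ∀ z, |g z| ≤ 1) (t : ℝ)
    {B : ℝ → ℝ} (hB : Integrable B (expMeasure α)) :
    Integrable (fun z : ℝ × EuclideanSpace ℝ (Fin d) => g (t + z.1, z.2) * B z.1)
      ((expMeasure α).prod σ) ∧
    ∫ z, g (t + z.1, z.2) * B z.1 ∂((expMeasure α).prod σ) =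
      ∫ u, meanRate σ g (t + u) * B u ∂expMeasure α := by
  have := isProbabilityMeasure_expMeasure hα
  have hi : Integrable (fun z : ℝ × EuclideanSpace ℝ (Fin d) => g (t + z.1, z.2) * B z.1)
      ((expMeasure α).prod σ) :=
    (hB.comp_fst σ).bdd_mul (c := 1) (Measurable.aestronglyMeasurable (by fun_prop))
      (ae_of_all _ fun z => hb _)
  refine ⟨hi, ?_⟩
  rw [integral_prod _ hi]
  simp_rw [integral_mul_const]
  rfl

/-- The compensated increments are centred, and their variance is the mean square of the kernel. -/
lemma compIncr_moments (hα : 0 < α) (hg : Measurable g) (hb : ∀ z, |g z| ≤ 1) (t : ℝ) :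
    ∫ z, compIncr α σ g (t, z) ∂((expMeasure α).prod σ) = 0 ∧
    Integrable (fun z => compIncr α σ g (t, z) ^ 2) ((expMeasure α).prod σ) ∧
    ∫ z, compIncr α σ g (t, z) ^ 2 ∂((expMeasure α).prod σ) =
      ∫ z, g (t + z.1, z.2) ^ 2 ∂((expMeasure α).prod σ) := by
  have := isProbabilityMeasure_expMeasure hα
  set f : ℝ → ℝ := fun v => meanRate σ g (t + v) with hf
  have hfm : StronglyMeasurable f := (stronglyMeasurable_meanRate hg).comp_measurable (by fun_prop)
  have hfb : ∀ v, ‖f v‖ ≤ 1 := fun v => abs_meanRate_le hb _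
  -- `B u` is the compensator accumulated over an inter-arrival period of length `u` starting at
  -- `t`.
  set B : ℝ → ℝ := fun u => α * ∫ v in Set.Ioc 0 u, f v with hB
  have hBm : StronglyMeasurable B := (stronglyMeasurable_setIntegral_Ioc hfm).const_mul α
  have hBb : ∀ u, |B u| ≤ α * |u| := fun u => by
    rw [hB, abs_mul, abs_of_pos hα]
    exact mul_le_mul_of_nonneg_left (setIntegral_meanRate_bound hb t u) hα.le
  have hBi : Integrable B (expMeasure α) := by
    refine ((integrable_pow_expMeasure hα 1).norm.const_mul α).mono' hBm.aestronglyMeasurable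
      (ae_of_all _ fun u => ?_)
    simpa using hBb u
  have hB2 : Integrable (fun u => B u ^ 2) (expMeasure α) := by
    refine ((integrable_pow_expMeasure hα 2).const_mul (α ^ 2)).mono'
      (hBm.pow 2).aestronglyMeasurable (ae_of_all _ fun u => ?_)
    have h := pow_le_pow_left₀ (abs_nonneg _) (hBb u) 2
    rw [mul_pow, sq_abs, sq_abs] at h
    simpa [Real.norm_eq_abs] using h
  have hfi : Integrable f (expMeasure α) :=
    Integrable.of_bound (C := 1) hfm.aestronglyMeasurable (ae_of_all _ hfb)
  have hconst : ∀ F : ℝ → ℝ, StronglyMeasurable F → Integrable F (expMeasure α) →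
      ∫ u, F u ∂expMeasure α = ∫ u, (α * ∫ v in Set.Ioc 0 u, F v) ∂expMeasure α := by
    intro F hFm hF
    have h := integral_mul_integral_translate_expMeasure hα hF hFm
      (stronglyMeasurable_const (b := (1 : ℝ))) (C := 1) (by simp)
    simpa using h
  have hmean : ∫ u, B u ∂expMeasure α = ∫ u, f u ∂expMeasure α := (hconst f hfm hfi).symm
  have hBf : Integrable (fun u => 2 * (f u * B u)) (expMeasure α) :=
    (hBi.bdd_mul (c := 1) hfm.aestronglyMeasurable (ae_of_all _ hfb)).const_mul 2
  -- Since `B ^ 2 = α ∫ 2 f B`, the two-arrival identity with test function `1` gives `E[B ^ 2] = 2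
  -- E[f B]`. This exactly cancels the cross term in the variance.
  have hsq : ∫ u, B u ^ 2 ∂expMeasure α = 2 * ∫ u, f u * B u ∂expMeasure α := by
    rw [← integral_const_mul, hconst (fun u => 2 * (f u * B u)) ((hfm.mul hBm).const_mul 2) hBf]
    congr 1; funext u
    have h := setIntegral_Ioc_pow_succ hfm hfb 1 u
    simp only [Nat.cast_one, pow_one] at h
    rw [hB, mul_pow, show (2 : ℕ) = 1 + 1 from rfl, h, ← integral_const_mul, ← integral_const_mul,
      ← integral_const_mul]
    congr 1; funext v
    simp only
    ring
  have hae : ∀ᵐ z ∂((expMeasure α).prod σ),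
      compIncr α σ g (t, z) = g (t + z.1, z.2) - B z.1 := by
    have hpos : ∀ᵐ z ∂((expMeasure α).prod σ), 0 < z.1 :=
      Measure.quasiMeasurePreserving_fst.ae ae_expMeasure_pos
    filter_upwards [hpos] with z hz
    simp only [compIncr, hB, hf]
    rw [cumMean_add_sub hg hb t hz.le]
  have hg1 := integrable_comp_add (σ := σ) hα hg hb t
  obtain ⟨hgB, hgBeq⟩ := integral_comp_mul (σ := σ) hα hg hb t hBi
  have hg2 : Integrable (fun z : ℝ × EuclideanSpace ℝ (Fin d) => g (t + z.1, z.2) ^ 2)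
      ((expMeasure α).prod σ) := by
    refine Integrable.of_bound (C := 1) (Measurable.aestronglyMeasurable (by fun_prop))
      (ae_of_all _ fun z => ?_)
    rw [Real.norm_eq_abs, abs_pow]
    exact pow_le_one₀ (abs_nonneg _) (hb _)
  have hae2 : ∀ᵐ z ∂((expMeasure α).prod σ), compIncr α σ g (t, z) ^ 2 =
      g (t + z.1, z.2) ^ 2 - 2 * (g (t + z.1, z.2) * B z.1) + B z.1 ^ 2 := by
    filter_upwards [hae] with z hz
    rw [hz]; ring
  refine ⟨?_, ?_, ?_⟩
  · have h1 : ∫ z : ℝ × EuclideanSpace ℝ (Fin d), g (t + z.1, z.2) ∂((expMeasure α).prod σ) =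
        ∫ u, f u ∂expMeasure α := integral_prod _ hg1
    rw [integral_congr_ae hae, integral_sub hg1 (hBi.comp_fst σ), h1, integral_fun_fst]
    simp [hmean]
  · exact ((hg2.sub (hgB.const_mul 2)).add (hB2.comp_fst σ)).congr (hae2.mono fun z h => h.symm)
  · rw [integral_congr_ae hae2, integral_add (by exact hg2.sub (hgB.const_mul 2)) (hB2.comp_fst σ),
      integral_sub hg2 (hgB.const_mul 2), integral_const_mul, hgBeq,
      integral_fun_fst (fun u => B u ^ 2)]
    simp [hsq, hf]

end Moments

end Compensated

/-! ### The compensated martingale -/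

section Martingale

variable {d : ℕ} {Ω : Type*} {α : ℝ}
  {σ : Measure (EuclideanSpace ℝ (Fin d))} {τ : ℕ → Ω → ℝ} {Δ : ℕ → Ω → EuclideanSpace ℝ (Fin d)}
  {g : ℝ × EuclideanSpace ℝ (Fin d) → ℝ}

/-- The compensated partial sums. -/
def compSum (α : ℝ) (σ : Measure (EuclideanSpace ℝ (Fin d))) (τ : ℕ → Ω → ℝ)
    (Δ : ℕ → Ω → EuclideanSpace ℝ (Fin d)) (g : ℝ × EuclideanSpace ℝ (Fin d) → ℝ)
    (k : ℕ) (ω : Ω) : ℝ :=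
  partialSum τ Δ g ω k - α * cumMean σ g (startTime τ k ω)

lemma compSum_succ (k : ℕ) (ω : Ω) : compSum α σ τ Δ g (k + 1) ω =
    compSum α σ τ Δ g k ω + compIncr α σ g (startTime τ k ω, τ k ω, Δ k ω) := by
  simp only [compSum, compIncr, startTime_succ, partialSum, Finset.sum_range_succ,
    arrival_eq_startTime_add]
  ring

lemma compSum_zero (ω : Ω) : compSum α σ τ Δ g 0 ω = 0 := by
  simp [compSum, partialSum, startTime, cumMean]

namespace IsInput

variable [mΩ : MeasurableSpace Ω] {P : Measure Ω} [IsProbabilityMeasure σ]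

lemma measurable_compSum_past (hi : IsInput P α σ τ Δ) (hg : Measurable g) (hb : ∀ z, |g z| ≤ 1)
    (k : ℕ) : Measurable[hi.past k] (compSum α σ τ Δ g k) :=
  (hi.measurable_partialSum_past hg le_rfl).sub
    (((continuous_cumMean hg hb).measurable.comp (hi.measurable_startTime_past k)).const_mul α)

lemma measurable_compIncr_mark (hi : IsInput P α σ τ Δ) (hg : Measurable g)
    (hb : ∀ z, |g z| ≤ 1) (k : ℕ) :
    Measurable (fun ω => compIncr α σ g (startTime τ k ω, τ k ω, Δ k ω)) :=
  (measurable_compIncr hg hb).comp ((hi.measurable_startTime k).prodMk (hi.measurable_mark k))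

variable [IsProbabilityMeasure P]

lemma lintegral_compIncr_sq (hi : IsInput P α σ τ Δ) (hα : 0 < α) (hg : Measurable g)
    (hb : ∀ z, |g z| ≤ 1) (k : ℕ) :
    ∫⁻ ω, ENNReal.ofReal (compIncr α σ g (startTime τ k ω, τ k ω, Δ k ω) ^ 2) ∂P =
      ∫⁻ ω, ENNReal.ofReal (g (arrival τ k ω, Δ k ω) ^ 2) ∂P := by
  have := isProbabilityMeasure_expMeasure hα
  have hm := measurable_compIncr (α := α) (σ := σ) hg hb
  simp_rw [arrival_eq_startTime_add]
  rw [hi.lintegral_mark (hi.measurable_startTime_past k)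
      (f := fun w => ENNReal.ofReal (compIncr α σ g w ^ 2)) (by fun_prop),
    hi.lintegral_mark (hi.measurable_startTime_past k)
      (f := fun w => ENNReal.ofReal (g (w.1 + w.2.1, w.2.2) ^ 2)) (by fun_prop)]
  refine lintegral_congr fun ω => ?_
  obtain ⟨-, h1, h2⟩ := compIncr_moments (σ := σ) hα hg hb (startTime τ k ω)
  have h3 : Integrable (fun z : ℝ × EuclideanSpace ℝ (Fin d) =>
      g (startTime τ k ω + z.1, z.2) ^ 2) ((expMeasure α).prod σ) := by
    refine Integrable.of_bound (C := 1) (Measurable.aestronglyMeasurable (by fun_prop))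
      (ae_of_all _ fun z => ?_)
    rw [Real.norm_eq_abs, abs_pow]
    exact pow_le_one₀ (abs_nonneg _) (hb _)
  rw [← lintegral_prod (μ := expMeasure α) (ν := σ)
      (fun z => ENNReal.ofReal (compIncr α σ g (startTime τ k ω, z) ^ 2)) (by fun_prop),
    ← lintegral_prod (μ := expMeasure α) (ν := σ)
      (fun z => ENNReal.ofReal (g (startTime τ k ω + z.1, z.2) ^ 2)) (by fun_prop),
    ← ofReal_integral_eq_lintegral_ofReal h1 (ae_of_all _ fun _ => sq_nonneg _), h2,
    ofReal_integral_eq_lintegral_ofReal h3 (ae_of_all _ fun _ => sq_nonneg _)]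

lemma memLp_compIncr (hi : IsInput P α σ τ Δ) (hα : 0 < α) (hg : Measurable g)
    (hb : ∀ z, |g z| ≤ 1) (k : ℕ) :
    MemLp (fun ω => compIncr α σ g (startTime τ k ω, τ k ω, Δ k ω)) 2 P := by
  rw [memLp_two_iff_integrable_sq (hi.measurable_compIncr_mark hg hb k).aestronglyMeasurable]
  refine ⟨((hi.measurable_compIncr_mark hg hb k).pow_const 2).aestronglyMeasurable, ?_⟩
  rw [hasFiniteIntegral_iff_ofReal (ae_of_all _ fun _ => sq_nonneg _),
    hi.lintegral_compIncr_sq hα hg hb]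
  refine lt_of_le_of_lt (lintegral_mono (g := fun _ => 1) fun ω => ?_) (by simp)
  rw [ENNReal.ofReal_le_one, ← sq_abs]
  exact pow_le_one₀ (abs_nonneg _) (hb _)

lemma memLp_compSum (hi : IsInput P α σ τ Δ) (hα : 0 < α) (hg : Measurable g)
    (hb : ∀ z, |g z| ≤ 1) (k : ℕ) : MemLp (compSum α σ τ Δ g k) 2 P := by
  induction k with
  | zero =>
    have : compSum α σ τ Δ g 0 = fun _ => 0 := funext compSum_zero
    rw [this]; exact memLp_const 0
  | succ k ih =>
    have : compSum α σ τ Δ g (k + 1) = compSum α σ τ Δ g k +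
      fun ω => compIncr α σ g (startTime τ k ω, τ k ω, Δ k ω) := funext (compSum_succ k)
    rw [this]
    exact ih.add (hi.memLp_compIncr hα hg hb k)

/-- Increments are orthogonal to the past: with `Y` and the starting time frozen, the increment is
centred. This yields both the martingale property and the additivity of variances. -/
lemma integral_mul_compIncr (hi : IsInput P α σ τ Δ) (hα : 0 < α) (hg : Measurable g)
    (hb : ∀ z, |g z| ≤ 1) {k : ℕ} {Y : Ω → ℝ} (hY : Measurable[hi.past k] Y) (hY2 : MemLp Y 2 P) :
    ∫ ω, Y ω * compIncr α σ g (startTime τ k ω, τ k ω, Δ k ω) ∂P = 0 := by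
  have := isProbabilityMeasure_expMeasure hα
  have hm := measurable_compIncr (α := α) (σ := σ) hg hb
  have hX : Measurable[hi.past k] (fun ω => (Y ω, startTime τ k ω)) :=
    hY.prodMk (hi.measurable_startTime_past k)
  have h := hi.integral_mark hX
    (f := fun w => w.1.1 * compIncr α σ g (w.1.2, w.2))
    (by apply Measurable.stronglyMeasurable; fun_prop)
    (hY2.integrable_mul (hi.memLp_compIncr hα hg hb k))
  rw [h]
  simp_rw [integral_const_mul, (compIncr_moments (σ := σ) hα hg hb _).1]
  simp

lemma integral_compSum_sq_succ (hi : IsInput P α σ τ Δ) (hα : 0 < α) (hg : Measurable g)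
    (hb : ∀ z, |g z| ≤ 1) (k : ℕ) :
    ∫ ω, compSum α σ τ Δ g (k + 1) ω ^ 2 ∂P = ∫ ω, compSum α σ τ Δ g k ω ^ 2 ∂P +
      ∫ ω, compIncr α σ g (startTime τ k ω, τ k ω, Δ k ω) ^ 2 ∂P := by
  have h1 := hi.memLp_compSum hα hg hb k
  have h2 := hi.memLp_compIncr hα hg hb k
  have h3 := hi.integral_mul_compIncr hα hg hb (hi.measurable_compSum_past hg hb k) h1
  simp_rw [compSum_succ, add_sq]
  rw [integral_add _ h2.integrable_sq, integral_add h1.integrable_sq]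
  · simp_rw [mul_assoc, integral_const_mul]
    rw [h3]; simp
  · simp_rw [mul_assoc]; exact (h1.integrable_mul h2).const_mul 2
  · refine h1.integrable_sq.add ?_
    simp_rw [mul_assoc]; exact (h1.integrable_mul h2).const_mul 2

lemma lintegral_compSum_sq_le (hi : IsInput P α σ τ Δ) (hα : 0 < α) (hg : Measurable g)
    (hb : ∀ z, |g z| ≤ 1) (k : ℕ) :
    ∫⁻ ω, ENNReal.ofReal (compSum α σ τ Δ g k ω ^ 2) ∂P ≤
      ENNReal.ofReal α *
        ∫⁻ z, ENNReal.ofReal (g z ^ 2) ∂((volume.restrict (Set.Ici 0)).prod σ) := by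
  have h : ∫⁻ ω, ENNReal.ofReal (compSum α σ τ Δ g k ω ^ 2) ∂P =
      ∑ j ∈ Finset.range k, ∫⁻ ω, ENNReal.ofReal (g (arrival τ j ω, Δ j ω) ^ 2) ∂P := by
    induction k with
    | zero => simp [compSum_zero]
    | succ k ih =>
      rw [Finset.sum_range_succ, ← ih, ← hi.lintegral_compIncr_sq hα hg hb k,
        ← ofReal_integral_eq_lintegral_ofReal (hi.memLp_compSum hα hg hb _).integrable_sq
          (ae_of_all _ fun _ => sq_nonneg _),
        ← ofReal_integral_eq_lintegral_ofReal (hi.memLp_compSum hα hg hb _).integrable_sq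
          (ae_of_all _ fun _ => sq_nonneg _),
        ← ofReal_integral_eq_lintegral_ofReal (hi.memLp_compIncr hα hg hb _).integrable_sq
          (ae_of_all _ fun _ => sq_nonneg _),
        ← ENNReal.ofReal_add (integral_nonneg fun _ => sq_nonneg _)
          (integral_nonneg fun _ => sq_nonneg _), hi.integral_compSum_sq_succ hα hg hb]
  rw [h]
  exact (ENNReal.sum_le_tsum _).trans
    (hi.tsum_lintegral_term_le hα (f := fun z => ENNReal.ofReal (g z ^ 2)) (by fun_prop))

lemma martingale_compSum (hi : IsInput P α σ τ Δ) (hα : 0 < α) (hg : Measurable g)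
    (hb : ∀ z, |g z| ≤ 1) : Martingale (compSum α σ τ Δ g) hi.past P := by
  have hint : ∀ k, Integrable (compSum α σ τ Δ g k) P := fun k =>
    (hi.memLp_compSum hα hg hb k).integrable (by norm_num)
  refine martingale_of_setIntegral_eq_succ
    (fun k => (hi.measurable_compSum_past hg hb k).stronglyMeasurable) hint fun k s hs => ?_
  have hs' : MeasurableSet s := hi.past.le k s hs
  have hD := (hi.memLp_compIncr hα hg hb k).integrable (by norm_num)
  simp_rw [compSum_succ]
  rw [integral_add (hint k).integrableOn hD.integrableOn]
  have h := hi.integral_mul_compIncr hα hg hb (k := k) (Y := s.indicator 1)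
    (measurable_const.indicator hs) ((memLp_const 1).indicator hs')
  have h2 : ∫ ω in s, compIncr α σ g (startTime τ k ω, τ k ω, Δ k ω) ∂P = 0 := by
    rw [← integral_indicator hs', ← h]
    congr 1; funext ω
    by_cases hω : ω ∈ s <;> simp [hω]
  rw [h2, add_zero]

/-- The compensated partial sums converge almost surely, with control of the second moment of the
limit. -/
lemma exists_limit_compSum (hi : IsInput P α σ τ Δ) (hα : 0 < α) (hg : Measurable g)
    (hb : ∀ z, |g z| ≤ 1)
    (hV : ∫⁻ z, ENNReal.ofReal (g z ^ 2) ∂((volume.restrict (Set.Ici 0)).prod σ) ≠ ⊤) :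
    ∃ L : Ω → ℝ, AEMeasurable L P ∧
      (∀ᵐ ω ∂P, Tendsto (fun k => compSum α σ τ Δ g k ω) atTop (𝓝 (L ω))) ∧
      ∫⁻ ω, ENNReal.ofReal (L ω ^ 2) ∂P ≤ ENNReal.ofReal α *
        ∫⁻ z, ENNReal.ofReal (g z ^ 2) ∂((volume.restrict (Set.Ici 0)).prod σ) := by
  set V := ENNReal.ofReal α *
        ∫⁻ z, ENNReal.ofReal (g z ^ 2) ∂((volume.restrict (Set.Ici 0)).prod σ) with hVdef
  have hVtop : V ≠ ⊤ := ENNReal.mul_ne_top ENNReal.ofReal_ne_top hV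
  have hm : ∀ k, Measurable (compSum α σ τ Δ g k) := fun k =>
    (hi.measurable_compSum_past hg hb k).mono (hi.past.le k) le_rfl
  -- The `L¹` bound needed for martingale convergence comes from the second moments through `|x| ≤ 1
  -- + x ^ 2`.
  have hbd : ∀ k, eLpNorm (compSum α σ τ Δ g k) 1 P ≤ ((1 + V).toNNReal : ENNReal) := by
    intro k
    rw [ENNReal.coe_toNNReal (by simp [hVtop]), eLpNorm_one_eq_lintegral_enorm]
    calc ∫⁻ ω, ‖compSum α σ τ Δ g k ω‖ₑ ∂P
        ≤ ∫⁻ ω, (1 + ENNReal.ofReal (compSum α σ τ Δ g k ω ^ 2)) ∂P := by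
          refine lintegral_mono fun ω => ?_
          rw [Real.enorm_eq_ofReal_abs, ← ENNReal.ofReal_one,
            ← ENNReal.ofReal_add zero_le_one (sq_nonneg _)]
          refine ENNReal.ofReal_le_ofReal ?_
          rw [← sq_abs]
          nlinarith [sq_nonneg (|compSum α σ τ Δ g k ω| - 1), abs_nonneg (compSum α σ τ Δ g k ω)]
      _ ≤ 1 + V := by
          rw [lintegral_add_left measurable_const]
          simpa using add_le_add_right (hi.lintegral_compSum_sq_le hα hg hb k) 1
  have hconv := (hi.martingale_compSum hα hg hb).submartingale.exists_ae_tendsto_of_bdd hbd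
  choose! L hL using fun ω (h : ∃ c, Tendsto (fun k => compSum α σ τ Δ g k ω) atTop (𝓝 c)) => h
  have hlim : ∀ᵐ ω ∂P, Tendsto (fun k => compSum α σ τ Δ g k ω) atTop (𝓝 (L ω)) :=
    hconv.mono fun ω h => hL ω h
  refine ⟨L, aemeasurable_of_tendsto_metrizable_ae atTop (fun k => (hm k).aemeasurable) hlim,
    hlim, ?_⟩
  calc ∫⁻ ω, ENNReal.ofReal (L ω ^ 2) ∂P
      -- Fatou's lemma passes the second moment bound to the limit.
      = ∫⁻ ω, liminf (fun k => ENNReal.ofReal (compSum α σ τ Δ g k ω ^ 2)) atTop ∂P := by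
        refine lintegral_congr_ae (hlim.mono fun ω h => ?_)
        exact (ENNReal.tendsto_ofReal (h.pow 2)).liminf_eq.symm
    _ ≤ liminf (fun k => ∫⁻ ω, ENNReal.ofReal (compSum α σ τ Δ g k ω ^ 2) ∂P) atTop :=
        lintegral_liminf_le fun k => by have := hm k; fun_prop
    _ ≤ V := by
        refine liminf_le_of_frequently_le' (Frequently.of_forall fun k => ?_)
        exact hi.lintegral_compSum_sq_le hα hg hb k

end IsInput

end Martingale

/-! ### Truncated kernels -/

section Truncation

variable {d : ℕ} {σ : Measure (EuclideanSpace ℝ (Fin d))}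
  {h k : ℝ × EuclideanSpace ℝ (Fin d) → ℝ}

/-- The intensity measure `λ ⊗ σ` on `ℝ₊ × ℝ^d`. -/
abbrev intensity (σ : Measure (EuclideanSpace ℝ (Fin d))) :
    Measure (ℝ × EuclideanSpace ℝ (Fin d)) :=
  (volume.restrict (Set.Ici 0)).prod σ

/-- The kernel with its values outside `[-1, 1]` replaced by `0`. -/
def trunc (h : ℝ × EuclideanSpace ℝ (Fin d) → ℝ) : ℝ × EuclideanSpace ℝ (Fin d) → ℝ :=
  Set.indicator {z | |h z| ≤ 1} h

lemma trunc_of_le {z : ℝ × EuclideanSpace ℝ (Fin d)} (hz : |h z| ≤ 1) : trunc h z = h z :=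
  Set.indicator_of_mem (s := {z | |h z| ≤ 1}) hz h

lemma trunc_of_lt {z : ℝ × EuclideanSpace ℝ (Fin d)} (hz : 1 < |h z|) : trunc h z = 0 :=
  Set.indicator_of_notMem (s := {z | |h z| ≤ 1}) (not_le.2 hz) h

lemma measurable_trunc (hh : Measurable h) : Measurable (trunc h) :=
  hh.indicator (measurableSet_le (by fun_prop) measurable_const)

lemma abs_trunc_le_one (h : ℝ × EuclideanSpace ℝ (Fin d) → ℝ) (z) : |trunc h z| ≤ 1 := by
  rcases le_or_gt |h z| 1 with hz | hz
  · rwa [trunc_of_le hz]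
  · simp [trunc_of_lt hz]

lemma restrict_compl_zero (hσ : σ {0} = 0) : σ.restrict {0}ᶜ = σ :=
  Measure.restrict_eq_self_of_ae_mem (compl_mem_ae_iff.2 hσ)

lemma truncSq_eq (hσ : σ {0} = 0) :
    truncSq σ h = ∫⁻ z, ENNReal.ofReal (min (|h z| ^ 2) 1) ∂intensity σ := by
  rw [truncSq, restrict_compl_zero hσ]

lemma lintegral_trunc_sq_le (hσ : σ {0} = 0) :
    ∫⁻ z, ENNReal.ofReal (trunc h z ^ 2) ∂intensity σ ≤ truncSq σ h := by
  rw [truncSq_eq hσ]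
  refine lintegral_mono fun z => ENNReal.ofReal_le_ofReal ?_
  rcases le_or_gt |h z| 1 with hz | hz
  · rw [trunc_of_le hz, sq_abs, le_min_iff]
    exact ⟨le_rfl, by rw [← sq_abs]; exact pow_le_one₀ (abs_nonneg _) hz⟩
  · rw [trunc_of_lt hz, zero_pow two_ne_zero]; positivity

lemma mul_intensity_le_truncSq (hσ : σ {0} = 0) (hh : Measurable h) {ε : ℝ} (hε : 0 < ε) :
    ENNReal.ofReal (min (ε ^ 2) 1) * intensity σ {z | ε ≤ |h z|} ≤ truncSq σ h := by
  rw [truncSq_eq hσ]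
  refine le_trans ?_ (mul_meas_ge_le_lintegral (by fun_prop) (ENNReal.ofReal (min (ε ^ 2) 1)))
  gcongr with z
  intro hz
  refine ENNReal.ofReal_le_ofReal (min_le_min_right _ ?_)
  exact pow_le_pow_left₀ hε.le hz 2

lemma intensity_le_truncSq (hσ : σ {0} = 0) (hh : Measurable h) :
    intensity σ {z | 1 < |h z|} ≤ truncSq σ h := by
  have := mul_intensity_le_truncSq hσ hh one_pos
  simp only [one_pow, min_self, ENNReal.ofReal_one, one_mul] at this
  exact (measure_mono fun z hz => le_of_lt (α := ℝ) hz).trans this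

lemma intensity_lt_top (hσ : σ {0} = 0) (hh : Measurable h) (ht : truncSq σ h < ⊤) {ε : ℝ}
    (hε : 0 < ε) : intensity σ {z | ε ≤ |h z|} < ⊤ := by
  have h1 := (mul_intensity_le_truncSq hσ hh hε).trans_lt ht
  have h0 : 0 < min (ε ^ 2) 1 := by positivity
  exact ENNReal.lt_top_of_mul_ne_top_right h1.ne (ENNReal.ofReal_pos.2 h0).ne'

lemma tendsto_intensity_zero (hσ : σ {0} = 0) {ks : ℕ → ℝ × EuclideanSpace ℝ (Fin d) → ℝ}
    (hk : ∀ n, Measurable (ks n)) (ht : Tendsto (fun n => truncSq σ (ks n)) atTop (𝓝 0))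
    {ε : ℝ} (hε : 0 < ε) :
    Tendsto (fun n => intensity σ {z | ε ≤ |ks n z|}) atTop (𝓝 0) := by
  have h0 : 0 < min (ε ^ 2) 1 := by positivity
  have hne : ENNReal.ofReal (min (ε ^ 2) 1) ≠ 0 :=
    (ENNReal.ofReal_pos.2 h0).ne'
  have h1 : Tendsto (fun n => truncSq σ (ks n) / ENNReal.ofReal (min (ε ^ 2) 1)) atTop (𝓝 0) := by
    have := ENNReal.Tendsto.div_const ht (b := ENNReal.ofReal (min (ε ^ 2) 1)) (Or.inr hne)
    simpa using this
  refine tendsto_of_tendsto_of_tendsto_of_le_of_le tendsto_const_nhds h1 (fun _ => zero_le)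
    fun n => ?_
  rw [ENNReal.le_div_iff_mul_le (Or.inl hne) (Or.inl ENNReal.ofReal_ne_top), mul_comm]
  exact mul_intensity_le_truncSq hσ (hk n) hε

lemma prod_restrict_Icc_eq [SFinite σ] (s : ℝ) :
    (volume.restrict (Set.Icc (0 : ℝ) s)).prod σ =
      (intensity σ).restrict (Set.Icc 0 s ×ˢ Set.univ) := by
  rw [← Measure.prod_restrict, Measure.restrict_restrict measurableSet_Icc, Measure.restrict_univ,
    Set.inter_eq_self_of_subset_left Set.Icc_subset_Ici_self]

lemma truncMean_eq_cumMean [IsProbabilityMeasure σ] (hσ : σ {0} = 0) (hh : Measurable h) {s : ℝ}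
    (hs : 0 ≤ s) : truncMean σ h s = cumMean σ (trunc h) s := by
  have hi : Integrable (trunc h) ((volume.restrict (Set.Icc (0 : ℝ) s)).prod σ) :=
    Integrable.of_bound (C := 1) (measurable_trunc hh).aestronglyMeasurable
      (ae_of_all _ (abs_trunc_le_one h))
  rw [truncMean, restrict_compl_zero hσ]
  change ∫ z, trunc h z ∂_ = _
  rw [integral_prod _ hi, cumMean, intervalIntegral.integral_of_le hs, integral_Icc_eq_integral_Ioc]
  rfl

end Truncation

/-! ### Almost sure convergence of the series -/

section Convergence

variable {d : ℕ} {Ω : Type*} [mΩ : MeasurableSpace Ω] {P : Measure Ω} {α : ℝ}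
  {σ : Measure (EuclideanSpace ℝ (Fin d))} {τ : ℕ → Ω → ℝ} {Δ : ℕ → Ω → EuclideanSpace ℝ (Fin d)}
  {h : ℝ × EuclideanSpace ℝ (Fin d) → ℝ} [IsProbabilityMeasure P] [IsProbabilityMeasure σ]

namespace IsInput

/-- The truncated series converges to `α * a` plus a centred variable of controlled variance. -/
lemma exists_limit_trunc (hi : IsInput P α σ τ Δ) (hα : 0 < α) (hσ : σ {0} = 0)
    (hh : Measurable h) (ht : truncSq σ h < ⊤) {a : ℝ}
    (ha : Tendsto (truncMean σ h) atTop (𝓝 a)) :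
    ∃ L : Ω → ℝ, AEMeasurable L P ∧
      (∀ᵐ ω ∂P, Tendsto (partialSum τ Δ (trunc h) ω) atTop (𝓝 (L ω + α * a))) ∧
      ∫⁻ ω, ENNReal.ofReal (L ω ^ 2) ∂P ≤ ENNReal.ofReal α * truncSq σ h := by
  have hV := lintegral_trunc_sq_le (h := h) hσ
  obtain ⟨L, hLm, hL, hL2⟩ := hi.exists_limit_compSum hα (measurable_trunc hh)
    (abs_trunc_le_one h) (hV.trans_lt ht).ne
  refine ⟨L, hLm, ?_, hL2.trans (by gcongr)⟩
  filter_upwards [hL, hi.ae_tendsto_arrival hα] with ω h1 h2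
  have h3 : Tendsto (fun k => startTime τ k ω) atTop atTop :=
    (tendsto_add_atTop_iff_nat (f := fun k => startTime τ k ω) 1).1 h2
  -- The compensator is the truncated mean evaluated at a random time that tends to infinity.
  have h4 : Tendsto (fun k => cumMean σ (trunc h) (startTime τ k ω)) atTop (𝓝 a) := by
    refine (ha.comp h3).congr' ?_
    filter_upwards [h3.eventually_ge_atTop 0] with k hk
    exact truncMean_eq_cumMean hσ hh hk
  refine (h1.add (h4.const_mul α)).congr fun k => ?_
  simp [compSum]

/-- Borel–Cantelli: the set `{|h| > 1}` has finite intensity, so truncation alters only finitely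
many terms. -/
lemma ae_eventually_le_one (hi : IsInput P α σ τ Δ) (hα : 0 < α) (hσ : σ {0} = 0)
    (hh : Measurable h) (ht : truncSq σ h < ⊤) :
    ∀ᵐ ω ∂P, ∀ᶠ k in atTop, |h (arrival τ k ω, Δ k ω)| ≤ 1 := by
  have h1 := hi.tsum_measure_term_le hα (B := {z | 1 < |h z|})
    (measurableSet_lt measurable_const (by fun_prop))
  have h2 : ∑' k, P {ω | (arrival τ k ω, Δ k ω) ∈ {z | 1 < |h z|}} ≠ ⊤ :=
    ne_top_of_le_ne_top (ENNReal.mul_ne_top ENNReal.ofReal_ne_top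
      ((intensity_le_truncSq hσ hh).trans_lt ht).ne) h1
  have h3 := measure_setOfPred_frequently_eq_zero h2
  filter_upwards [measure_eq_zero_iff_ae_notMem.1 h3] with ω hω
  simpa [Filter.Frequently] using hω

lemma ae_exists_tendsto_partialSum (hi : IsInput P α σ τ Δ) (hα : 0 < α) (hσ : σ {0} = 0)
    (hk : IsKernel σ h) : ∀ᵐ ω ∂P, ∃ l, Tendsto (partialSum τ Δ h ω) atTop (𝓝 l) := by
  obtain ⟨a, ha⟩ := hk.exists_drift
  obtain ⟨L, -, hL, -⟩ := hi.exists_limit_trunc hα hσ hk.measurable hk.truncSq_lt_top ha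
  filter_upwards [hL, hi.ae_eventually_le_one hα hσ hk.measurable hk.truncSq_lt_top] with ω h1 h2
  obtain ⟨N, hN⟩ := eventually_atTop.1 h2
  refine ⟨_, (h1.add_const (partialSum τ Δ h ω N - partialSum τ Δ (trunc h) ω N)).congr' ?_⟩
  filter_upwards [eventually_ge_atTop N] with k hk
  induction k, hk using Nat.le_induction with
  | base => ring
  | succ k hk ih =>
    simp only [partialSum, Finset.sum_range_succ] at ih ⊢
    rw [trunc_of_le (hN k hk), ← ih]
    ring

lemma ae_tendsto_series (hi : IsInput P α σ τ Δ) (hα : 0 < α) (hσ : σ {0} = 0)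
    (hk : IsKernel σ h) :
    ∀ᵐ ω ∂P, Tendsto (partialSum τ Δ h ω) atTop (𝓝 (series τ Δ h ω)) := by
  filter_upwards [hi.ae_exists_tendsto_partialSum hα hσ hk] with ω hω
  exact tendsto_nhds_limUnder hω

lemma aemeasurable_series (hi : IsInput P α σ τ Δ) (hα : 0 < α) (hσ : σ {0} = 0)
    (hk : IsKernel σ h) : AEMeasurable (series τ Δ h) P :=
  aemeasurable_of_tendsto_metrizable_ae atTop
    (fun k => (hi.measurable_partialSum hk.measurable k).aemeasurable)
    (hi.ae_tendsto_series hα hσ hk)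

/-- A kernel of small truncated square has a series close to its mean `α * a`. -/
lemma measure_limit_sub_drift_le (hi : IsInput P α σ τ Δ) (hα : 0 < α) (hσ : σ {0} = 0)
    (hh : Measurable h) (ht : truncSq σ h < ⊤) {a : ℝ}
    (ha : Tendsto (truncMean σ h) atTop (𝓝 a)) {S : Ω → ℝ}
    (hS : ∀ᵐ ω ∂P, Tendsto (partialSum τ Δ h ω) atTop (𝓝 (S ω))) {ε : ℝ} (hε : 0 < ε) :
    P {ω | ε ≤ |S ω - α * a|} ≤ ENNReal.ofReal α * truncSq σ h +
      ENNReal.ofReal α * truncSq σ h / ENNReal.ofReal (ε ^ 2) := by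
  obtain ⟨L, hLm, hL, hL2⟩ := hi.exists_limit_trunc hα hσ hh ht ha
  -- Off `B` truncation changes no term and Chebyshev's inequality for `L` applies; `B` itself is
  -- estimated by a union bound.
  set B : Set Ω := ⋃ k, {ω | (arrival τ k ω, Δ k ω) ∈ {z | 1 < |h z|}} with hB
  have h1 : P B ≤ ENNReal.ofReal α * truncSq σ h := by
    refine (measure_iUnion_le _).trans ((hi.tsum_measure_term_le hα
      (measurableSet_lt measurable_const (by fun_prop))).trans ?_)
    gcongr
    exact intensity_le_truncSq hσ hh
  have h2 : P {ω | ε ≤ |L ω|} ≤ ENNReal.ofReal α * truncSq σ h / ENNReal.ofReal (ε ^ 2) := by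
    have hne : ENNReal.ofReal (ε ^ 2) ≠ 0 := by simp; positivity
    rw [ENNReal.le_div_iff_mul_le (Or.inl hne) (Or.inl ENNReal.ofReal_ne_top), mul_comm]
    refine le_trans ?_ ((mul_meas_ge_le_lintegral₀ (f := fun ω => ENNReal.ofReal (L ω ^ 2))
      (by fun_prop) (ENNReal.ofReal (ε ^ 2))).trans hL2)
    gcongr with ω
    intro hω
    rw [← sq_abs (L ω)]
    exact ENNReal.ofReal_le_ofReal (pow_le_pow_left₀ hε.le hω 2)
  refine le_trans (measure_mono_ae ?_) ((measure_union_le B {ω | ε ≤ |L ω|}).trans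
    (add_le_add h1 h2))
  filter_upwards [hL, hS] with ω h3 h4 h5
  by_cases hωB : ω ∈ B
  · exact Or.inl hωB
  · right
    have h6 : partialSum τ Δ h ω = partialSum τ Δ (trunc h) ω := by
      funext k
      refine Finset.sum_congr rfl fun j _ => ?_
      rw [trunc_of_le]
      simp only [hB, Set.mem_iUnion, not_exists] at hωB
      exact not_lt.1 (hωB j)
    rw [h6] at h4
    have h7 := tendsto_nhds_unique h4 h3
    have h8 : ε ≤ |S ω - α * a| := h5
    rw [h7, add_sub_cancel_right] at h8
    exact h8

end IsInput

end Convergence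

/-! ### The drift of a difference of kernels -/

section Drift

variable {d : ℕ} {σ : Measure (EuclideanSpace ℝ (Fin d))}
  {h k : ℝ × EuclideanSpace ℝ (Fin d) → ℝ}

/-- The defect of additivity of truncation. -/
def truncDefect (k h : ℝ × EuclideanSpace ℝ (Fin d) → ℝ) (z : ℝ × EuclideanSpace ℝ (Fin d)) : ℝ :=
  trunc k z - trunc h z - trunc (fun z => k z - h z) z

lemma measurable_truncDefect (hk : Measurable k) (hh : Measurable h) :
    Measurable (truncDefect k h) :=
  ((measurable_trunc hk).sub (measurable_trunc hh)).sub (measurable_trunc (hk.sub hh))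

lemma abs_truncDefect_le_three (z : ℝ × EuclideanSpace ℝ (Fin d)) : |truncDefect k h z| ≤ 3 := by
  have h1 := abs_le.1 (abs_trunc_le_one k z)
  have h2 := abs_le.1 (abs_trunc_le_one h z)
  have h3 := abs_le.1 (abs_trunc_le_one (fun z => k z - h z) z)
  rw [truncDefect, abs_le]
  constructor <;> linarith [h1.1, h1.2, h2.1, h2.2, h3.1, h3.2]

/-- If `|h|` is farther than `δ` from the level `1` and `k` is within `δ` of `h`, both lie on the
same side of that level. Below it the defect vanishes; above it only `h - k` survives. -/
lemma abs_truncDefect_le {z : ℝ × EuclideanSpace ℝ (Fin d)} {δ : ℝ} (hδ1 : δ < 1)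
    (h1 : |k z - h z| < δ) (h2 : δ < |(|h z| - 1)|) :
    |truncDefect k h z| ≤ Set.indicator {z | 1 ≤ |h z|} (fun _ => δ) z := by
  have hk : |(|k z| - |h z|)| < δ := (abs_abs_sub_abs_le _ _).trans_lt h1
  have hk' := abs_lt.1 hk
  have e3 : trunc (fun z => k z - h z) z = k z - h z := trunc_of_le (h1.le.trans hδ1.le)
  rcases le_or_gt 1 |h z| with hz | hz
  · rw [abs_of_nonneg (by linarith)] at h2
    rw [Set.indicator_of_mem (show z ∈ {z | 1 ≤ |h z|} from hz), truncDefect, e3,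
      trunc_of_lt (h := h) (by linarith [abs_nonneg (k z - h z)]),
      trunc_of_lt (h := k) (by linarith [hk'.1])]
    simpa [abs_sub_comm] using h1.le
  · rw [abs_of_neg (by linarith)] at h2
    rw [Set.indicator_of_notMem (show z ∉ {z | 1 ≤ |h z|} from not_le.2 hz), truncDefect, e3,
      trunc_of_le (h := h) hz.le, trunc_of_le (h := k) (by linarith [hk'.2])]
    simp

lemma lintegral_truncDefect_le (hk : Measurable k) (hh : Measurable h) {δ : ℝ} (hδ1 : δ < 1) :
    ∫⁻ z, ENNReal.ofReal |truncDefect k h z| ∂intensity σ ≤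
      3 * intensity σ {z | δ ≤ |k z - h z|} +
        (3 * intensity σ {z | |(|h z| - 1)| ≤ δ} +
          ENNReal.ofReal δ * intensity σ {z | 1 ≤ |h z|}) := by
  have mA : MeasurableSet {z | δ ≤ |k z - h z|} := measurableSet_le measurable_const (by fun_prop)
  have mB : MeasurableSet {z | |(|h z| - 1)| ≤ δ} := measurableSet_le (by fun_prop) measurable_const
  have mC : MeasurableSet {z | 1 ≤ |h z|} := measurableSet_le measurable_const (by fun_prop)
  rw [← lintegral_indicator_const mA, ← lintegral_indicator_const mB,
    ← lintegral_indicator_const mC, ← lintegral_add_left (measurable_const.indicator mB),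
    ← lintegral_add_left (measurable_const.indicator mA)]
  refine lintegral_mono fun z => ?_
  have h3 : ENNReal.ofReal |truncDefect k h z| ≤ 3 := by
    refine (ENNReal.ofReal_le_ofReal (abs_truncDefect_le_three z)).trans (by simp)
  by_cases hA : δ ≤ |k z - h z|
  · refine le_add_right (h3.trans ?_)
    rw [Set.indicator_of_mem (show z ∈ {z | δ ≤ |k z - h z|} from hA)]
  · refine le_add_left ?_
    by_cases hB : |(|h z| - 1)| ≤ δ
    · refine le_add_right (h3.trans ?_)
      rw [Set.indicator_of_mem (show z ∈ {z | |(|h z| - 1)| ≤ δ} from hB)]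
    · refine le_add_left ?_
      have := abs_truncDefect_le hδ1 (not_le.1 hA) (not_le.1 hB)
      refine (ENNReal.ofReal_le_ofReal this).trans (le_of_eq ?_)
      by_cases hC : 1 ≤ |h z|
      · simp [Set.indicator, hC]
      · simp [Set.indicator, hC]

/-- The shift by `2` keeps every threshold at most `1 / 2`, hence below `1` as the defect bound
requires. -/
lemma tendsto_one_div_add_two : Tendsto (fun j : ℕ => 1 / ((j : ℝ) + 2)) atTop (𝓝 0) := by
  have := (tendsto_one_div_add_atTop_nhds_zero_nat (𝕜 := ℝ)).comp (tendsto_add_atTop_nat 1)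
  refine this.congr fun j => ?_
  simp only [Function.comp, Nat.cast_add, Nat.cast_one]
  ring

lemma tendsto_intensity_near_one (hσ : σ {0} = 0) (hh : Measurable h) (ht : truncSq σ h < ⊤)
    (hat : intensity σ {z | |h z| = 1} = 0) :
    Tendsto (fun j : ℕ => intensity σ {z | |(|h z| - 1)| ≤ 1 / ((j : ℝ) + 2)}) atTop (𝓝 0) := by
  have hm : ∀ j : ℕ, MeasurableSet {z | |(|h z| - 1)| ≤ 1 / ((j : ℝ) + 2)} := fun j =>
    measurableSet_le (by fun_prop) measurable_const
  have hlim := tendsto_one_div_add_two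
  have hI : ⋂ j : ℕ, {z | |(|h z| - 1)| ≤ 1 / ((j : ℝ) + 2)} ⊆ {z | |h z| = 1} := by
    intro z hz
    simp only [Set.mem_iInter, Set.mem_ofPred_eq] at hz
    have := ge_of_tendsto' hlim hz
    have h0 := abs_eq_zero.1 (le_antisymm this (abs_nonneg _))
    exact sub_eq_zero.1 h0
  have key := tendsto_measure_iInter_atTop (μ := intensity σ)
    (s := fun j : ℕ => {z | |(|h z| - 1)| ≤ 1 / ((j : ℝ) + 2)})
    (fun j => (hm j).nullMeasurableSet) ?_ ⟨0, ?_⟩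
  · rwa [measure_mono_null hI hat] at key
  · intro i j hij z hz
    refine le_trans (b := 1 / ((j : ℝ) + 2)) hz ?_
    gcongr
  -- Continuity from above needs one set of finite measure; the one with `j = 0` lies in `{1 / 2 ≤
  -- |h|}`.
  · refine ((measure_mono ?_).trans_lt
      (intensity_lt_top hσ hh ht (ε := 1 / 2) (by norm_num))).ne
    intro z hz
    have hz' : |(|h z| - 1)| ≤ 1 / (((0 : ℕ) : ℝ) + 2) := hz
    have := (abs_le.1 hz').1
    norm_num at this ⊢
    linarith

variable {hs : ℕ → ℝ × EuclideanSpace ℝ (Fin d) → ℝ}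

lemma tendsto_lintegral_truncDefect (hσ : σ {0} = 0) (hh : Measurable h) (ht : truncSq σ h < ⊤)
    (hat : intensity σ {z | |h z| = 1} = 0) (hsm : ∀ n, Measurable (hs n))
    (hsq : Tendsto (fun n => truncSq σ (fun z => hs n z - h z)) atTop (𝓝 0)) :
    Tendsto (fun n => ∫⁻ z, ENNReal.ofReal |truncDefect (hs n) h z| ∂intensity σ) atTop (𝓝 0) := by
  have hC := intensity_lt_top hσ hh ht one_pos
  have hlim := tendsto_one_div_add_two
  have h1 : Tendsto (fun j : ℕ => 3 * intensity σ {z | |(|h z| - 1)| ≤ 1 / ((j : ℝ) + 2)} +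
      ENNReal.ofReal (1 / ((j : ℝ) + 2)) * intensity σ {z | 1 ≤ |h z|}) atTop (𝓝 0) := by
    have a1 := ENNReal.Tendsto.const_mul (a := 3) (tendsto_intensity_near_one hσ hh ht hat)
      (Or.inr (by simp))
    have a2 := ENNReal.Tendsto.mul_const (b := intensity σ {z | 1 ≤ |h z|})
      (ENNReal.tendsto_ofReal hlim) (Or.inr hC.ne)
    simpa using a1.add a2
  rw [ENNReal.tendsto_nhds_zero]
  intro ε hε
  have hε2 : 0 < ε / 2 := ENNReal.half_pos hε.ne'
  obtain ⟨j, hj⟩ := ((ENNReal.tendsto_nhds_zero.1 h1) (ε / 2) hε2).exists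
  have hδ0 : (0 : ℝ) < 1 / ((j : ℝ) + 2) := by positivity
  have hδ1 : 1 / ((j : ℝ) + 2) < 1 := by
    rw [div_lt_one (by positivity)]
    linarith [j.cast_nonneg (α := ℝ)]
  have h2 := ENNReal.Tendsto.const_mul (a := 3)
    (tendsto_intensity_zero hσ (fun n => (hsm n).sub hh) hsq hδ0) (Or.inr (by simp))
  rw [mul_zero] at h2
  filter_upwards [(ENNReal.tendsto_nhds_zero.1 h2) (ε / 2) hε2] with n hn
  refine (lintegral_truncDefect_le (hsm n) hh hδ1).trans ?_
  rw [← ENNReal.add_halves ε]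
  exact add_le_add hn hj

/-- On each `[0, s]` the integrands are bounded and the measure finite, so the truncated means
differ by exactly the integral of the defect. Integrability of the defect lets `s → ∞`. -/
lemma tendsto_truncMean_sub [IsProbabilityMeasure σ] (hσ : σ {0} = 0) (hk : Measurable k)
    (hh : Measurable h)
    (hint : ∫⁻ z, ENNReal.ofReal |truncDefect k h z| ∂intensity σ < ⊤) {a b : ℝ}
    (ha : Tendsto (truncMean σ k) atTop (𝓝 a)) (hb : Tendsto (truncMean σ h) atTop (𝓝 b)) :
    Tendsto (truncMean σ (fun z => k z - h z)) atTop
      (𝓝 (a - b - ∫ z, truncDefect k h z ∂intensity σ)) := by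
  have hI : Integrable (truncDefect k h) (intensity σ) := by
    refine ⟨(measurable_truncDefect hk hh).aestronglyMeasurable, ?_⟩
    rw [hasFiniteIntegral_iff_norm]
    exact hint
  have hcov : AECover (intensity σ) (atTop : Filter ℝ)
      (fun s => Set.Icc (0 : ℝ) s ×ˢ (Set.univ : Set (EuclideanSpace ℝ (Fin d)))) := by
    refine ⟨?_, fun s => measurableSet_Icc.prod MeasurableSet.univ⟩
    have h0 : ∀ᵐ z ∂intensity σ, 0 ≤ z.1 :=
      Measure.quasiMeasurePreserving_fst.ae (ae_restrict_mem measurableSet_Ici)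
    filter_upwards [h0] with z hz
    filter_upwards [eventually_ge_atTop z.1] with s hs
    exact ⟨⟨hz, hs⟩, trivial⟩
  have hlim := hcov.integral_tendsto_of_countably_generated hI
  refine ((ha.sub hb).sub hlim).congr fun s => ?_
  rw [← prod_restrict_Icc_eq, truncMean, truncMean, truncMean, restrict_compl_zero hσ]
  have hi : ∀ f : ℝ × EuclideanSpace ℝ (Fin d) → ℝ, Measurable f →
      Integrable (trunc f) ((volume.restrict (Set.Icc (0 : ℝ) s)).prod σ) := fun f hf =>
    Integrable.of_bound (C := 1) (measurable_trunc hf).aestronglyMeasurable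
      (ae_of_all _ (abs_trunc_le_one f))
  change (∫ z, trunc k z ∂_) - (∫ z, trunc h z ∂_) - ∫ z, truncDefect k h z ∂_ =
    ∫ z, trunc (fun z => k z - h z) z ∂_
  simp only [truncDefect]
  rw [integral_sub (by exact (hi k hk).sub (hi h hh)) (hi (fun z => k z - h z) (hk.sub hh)),
    integral_sub (hi k hk) (hi h hh)]
  ring

/-- If the intensity does not charge `{|h| = 1}`, the drifts of `hs n - h` exist and tend to `0`. -/
lemma exists_tendsto_drift_sub [IsProbabilityMeasure σ] (hσ : σ {0} = 0) (hker : IsKernel σ h)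
    (hsker : ∀ n, IsKernel σ (hs n)) (hat : intensity σ {z | |h z| = 1} = 0)
    (hdrift : Tendsto (fun n => drift σ (hs n)) atTop (𝓝 (drift σ h)))
    (hsq : Tendsto (fun n => truncSq σ (fun z => hs n z - h z)) atTop (𝓝 0)) :
    ∃ a : ℕ → ℝ, Tendsto a atTop (𝓝 0) ∧
      ∀ᶠ n in atTop, Tendsto (truncMean σ (fun z => hs n z - h z)) atTop (𝓝 (a n)) := by
  have hlim := tendsto_lintegral_truncDefect hσ hker.measurable hker.truncSq_lt_top hat
    (fun n => (hsker n).measurable) hsq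
  refine ⟨fun n => drift σ (hs n) - drift σ h - ∫ z, truncDefect (hs n) h z ∂intensity σ, ?_, ?_⟩
  · have h1 : Tendsto (fun n => ∫ z, truncDefect (hs n) h z ∂intensity σ) atTop (𝓝 0) := by
      rw [tendsto_zero_iff_norm_tendsto_zero]
      have h2 := (ENNReal.tendsto_toReal ENNReal.zero_ne_top).comp hlim
      rw [ENNReal.toReal_zero] at h2
      exact squeeze_zero (fun _ => norm_nonneg _) (fun n => norm_integral_le_lintegral_norm _) h2
    have := (hdrift.sub_const (drift σ h)).sub h1
    simpa using this
  -- The defect is known to be integrable only for large `n`, hence the eventual statement.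
  · filter_upwards [(tendsto_order.1 hlim).2 ⊤ (by simp)] with n hn
    exact tendsto_truncMean_sub hσ (hsker n).measurable hker.measurable hn
      (tendsto_nhds_limUnder (hsker n).exists_drift) (tendsto_nhds_limUnder hker.exists_drift)

/-- Truncation at level `1` is discontinuous exactly at the values `±1`. Absolute continuity of the
convolution power rules out atoms of the image measure there. -/
lemma intensity_abs_eq_one [IsProbabilityMeasure σ] (hh : Measurable h) {p : ℕ}
    (hac : convPow (imageMeasure σ (Set.Ici 0) h) p ≪ volume) :
    intensity σ {z | |h z| = 1} = 0 := by
  have : SFinite (imageMeasure σ (Set.Ici 0) h) := by unfold imageMeasure; infer_instance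
  have key : ∀ a : ℝ, intensity σ (h ⁻¹' {a}) = 0 := fun a => by
    rw [← singleton_eq_zero_of_convPow_absolutelyContinuous hac a, imageMeasure,
      Measure.map_apply hh (measurableSet_singleton a)]
  have hsub : {z | |h z| = 1} ⊆ h ⁻¹' {1} ∪ h ⁻¹' {-1} := fun z hz =>
    (abs_eq zero_le_one).1 hz
  exact measure_mono_null hsub (measure_union_null (key 1) (key (-1)))

end Drift

/-! ### Convergence in probability -/

section InProbability

lemma tendstoInMeasure_sub {Ω : Type*} [MeasurableSpace Ω] {P : Measure Ω}
    {X Y : ℕ → Ω → ℝ} {X' Y' : Ω → ℝ} (hX : TendstoInMeasure P X atTop X')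
    (hY : TendstoInMeasure P Y atTop Y') :
    TendstoInMeasure P (fun n ω => X n ω - Y n ω) atTop (fun ω => X' ω - Y' ω) := by
  rw [tendstoInMeasure_iff_norm] at *
  intro ε hε
  have h := (hX (ε / 2) (half_pos hε)).add (hY (ε / 2) (half_pos hε))
  rw [add_zero] at h
  refine tendsto_of_tendsto_of_tendsto_of_le_of_le tendsto_const_nhds h (fun _ => zero_le)
    fun n => (measure_mono ?_).trans (measure_union_le _ _)
  intro ω hω
  by_contra hcon
  simp only [Set.mem_union, Set.mem_ofPred_eq, not_or, not_le] at hcon hω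
  have h1 : X n ω - Y n ω - (X' ω - Y' ω) = (X n ω - X' ω) - (Y n ω - Y' ω) := by ring
  rw [h1] at hω
  linarith [norm_sub_le (X n ω - X' ω) (Y n ω - Y' ω), hcon.1, hcon.2]

variable {d : ℕ} {Ω : Type*} [mΩ : MeasurableSpace Ω] {P : Measure Ω} {α : ℝ}
  {σ : Measure (EuclideanSpace ℝ (Fin d))} {τ : ℕ → Ω → ℝ} {Δ : ℕ → Ω → EuclideanSpace ℝ (Fin d)}
  {h : ℝ × EuclideanSpace ℝ (Fin d) → ℝ} {hs : ℕ → ℝ × EuclideanSpace ℝ (Fin d) → ℝ}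
  [IsProbabilityMeasure P] [IsProbabilityMeasure σ]

namespace IsInput

lemma tendstoInMeasure_partialSum (hi : IsInput P α σ τ Δ) (hα : 0 < α) (hσ : σ {0} = 0)
    (hh : Measurable h) (hsm : ∀ n, Measurable (hs n))
    (hsq : Tendsto (fun n => truncSq σ (fun z => hs n z - h z)) atTop (𝓝 0)) (p : ℕ) :
    TendstoInMeasure P (fun n ω => partialSum τ Δ (hs n) ω p) atTop
      (fun ω => partialSum τ Δ h ω p) := by
  induction p with
  | zero =>
    simp only [partialSum, Finset.range_zero, Finset.sum_empty]
    rw [tendstoInMeasure_iff_norm]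
    intro ε hε
    simp [hε.not_ge]
  | succ p ih =>
    -- The sign turns the difference lemma into one for sums.
    have hterm : TendstoInMeasure P (fun n ω => - hs n (arrival τ p ω, Δ p ω)) atTop
        (fun ω => - h (arrival τ p ω, Δ p ω)) := by
      rw [tendstoInMeasure_iff_norm]
      intro ε hε
      have h1 := ENNReal.Tendsto.const_mul (a := ENNReal.ofReal α)
        (tendsto_intensity_zero hσ (fun n => (hsm n).sub hh) hsq hε) (Or.inr (by simp))
      rw [mul_zero] at h1
      refine tendsto_of_tendsto_of_tendsto_of_le_of_le tendsto_const_nhds h1 (fun _ => zero_le)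
        fun n => ?_
      have h2 := hi.tsum_measure_term_le hα (B := {z | ε ≤ |hs n z - h z|})
        (measurableSet_le measurable_const (by have := hsm n; fun_prop))
      refine le_trans (le_trans (measure_mono ?_) (ENNReal.le_tsum p)) h2
      intro ω hω
      simp only [Set.mem_ofPred_eq, Real.norm_eq_abs] at hω ⊢
      rwa [neg_sub_neg, abs_sub_comm] at hω
    have := tendstoInMeasure_sub ih hterm
    simpa only [partialSum, Finset.sum_range_succ, sub_neg_eq_add] using this

/-- The difference of the series is almost surely the series of `hs n - h`. Half of `ε` bounds its
deviation from the mean `α * a n`, the other half the mean itself. -/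
lemma tendstoInMeasure_series (hi : IsInput P α σ τ Δ) (hα : 0 < α) (hσ : σ {0} = 0)
    (hker : IsKernel σ h) (hsker : ∀ n, IsKernel σ (hs n))
    (hat : intensity σ {z | |h z| = 1} = 0)
    (hdrift : Tendsto (fun n => drift σ (hs n)) atTop (𝓝 (drift σ h)))
    (hsq : Tendsto (fun n => truncSq σ (fun z => hs n z - h z)) atTop (𝓝 0)) :
    TendstoInMeasure P (fun n => series τ Δ (hs n)) atTop (series τ Δ h) := by
  obtain ⟨a, ha, hmean⟩ := exists_tendsto_drift_sub hσ hker hsker hat hdrift hsq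
  rw [tendstoInMeasure_iff_norm]
  intro ε hε
  have hne : ENNReal.ofReal ((ε / 2) ^ 2) ≠ 0 := by
    have : 0 < (ε / 2) ^ 2 := by positivity
    exact (ENNReal.ofReal_pos.2 this).ne'
  have h1 := ENNReal.Tendsto.const_mul (a := ENNReal.ofReal α) hsq (Or.inr (by simp))
  have h2 := h1.add (ENNReal.Tendsto.div_const h1 (b := ENNReal.ofReal ((ε / 2) ^ 2)) (Or.inr hne))
  rw [mul_zero, ENNReal.zero_div, add_zero] at h2
  have hsmall : ∀ᶠ n in atTop, |α * a n| < ε / 2 := by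
    have := (ha.const_mul α).abs
    rw [mul_zero, abs_zero] at this
    exact (tendsto_order.1 this).2 _ (half_pos hε)
  refine tendsto_of_tendsto_of_tendsto_of_le_of_le' tendsto_const_nhds h2
    (Eventually.of_forall fun _ => zero_le) ?_
  filter_upwards [hsmall, hmean, (tendsto_order.1 hsq).2 ⊤ (by simp)] with n hn hmn htn
  have hS : ∀ᵐ ω ∂P, Tendsto (partialSum τ Δ (fun z => hs n z - h z) ω) atTop
      (𝓝 (series τ Δ (hs n) ω - series τ Δ h ω)) := by
    filter_upwards [hi.ae_tendsto_series hα hσ (hsker n), hi.ae_tendsto_series hα hσ hker]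
      with ω h3 h4
    refine (h3.sub h4).congr fun k => ?_
    simp [partialSum]
  refine le_trans (measure_mono ?_) (hi.measure_limit_sub_drift_le hα hσ
    ((hsker n).measurable.sub hker.measurable) htn hmn hS (half_pos hε))
  intro ω hω
  simp only [Set.mem_ofPred_eq, Real.norm_eq_abs] at hω ⊢
  have := abs_sub_abs_le_abs_sub (series τ Δ (hs n) ω - series τ Δ h ω) (α * a n)
  linarith

end IsInput

end InProbability

/-! ### The characteristic function of the series -/

/-- The character `y ↦ exp (i ξ y)`. -/
def character (ξ y : ℝ) : ℂ := Complex.exp (ξ * y * Complex.I)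

@[simp] lemma norm_character (ξ y : ℝ) : ‖character ξ y‖ = 1 := by
  rw [character, ← Complex.ofReal_mul, Complex.norm_exp_ofReal_mul_I]

@[simp] lemma character_zero_right (ξ : ℝ) : character ξ 0 = 1 := by simp [character]

@[simp] lemma character_zero_left (y : ℝ) : character 0 y = 1 := by simp [character]

lemma character_add (ξ x y : ℝ) : character ξ (x + y) = character ξ x * character ξ y := by
  rw [character, character, character, ← Complex.exp_add]
  push_cast
  ring_nf

@[fun_prop]
lemma continuous_character (ξ : ℝ) : Continuous (character ξ) := by
  unfold character; fun_prop

@[fun_prop]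
lemma measurable_character (ξ : ℝ) : Measurable (character ξ) :=
  (continuous_character ξ).measurable

section CharFun

variable {d : ℕ} {σ : Measure (EuclideanSpace ℝ (Fin d))}
  {h : ℝ × EuclideanSpace ℝ (Fin d) → ℝ}

/-- The characteristic function of `h (t, x)` when `x` has law `σ`. -/
def rateChar (σ : Measure (EuclideanSpace ℝ (Fin d))) (h : ℝ × EuclideanSpace ℝ (Fin d) → ℝ)
    (ξ t : ℝ) : ℂ := ∫ x, character ξ (h (t, x)) ∂σ

/-- The integral of `rateChar` over `[0, s]`. -/
def cumChar (σ : Measure (EuclideanSpace ℝ (Fin d))) (h : ℝ × EuclideanSpace ℝ (Fin d) → ℝ)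
    (ξ s : ℝ) : ℂ := ∫ t in Set.Ioc 0 s, rateChar σ h ξ t

lemma stronglyMeasurable_rateChar [SFinite σ] (hh : Measurable h) (ξ : ℝ) :
    StronglyMeasurable (rateChar σ h ξ) :=
  (show Measurable (fun z => character ξ (h z)) by fun_prop).stronglyMeasurable.integral_prod_right'

lemma norm_rateChar_le [IsProbabilityMeasure σ] (ξ t : ℝ) : ‖rateChar σ h ξ t‖ ≤ 1 := by
  have := norm_integral_le_of_norm_le_const (μ := σ) (f := fun x => character ξ (h (t, x))) (C := 1)
    (ae_of_all _ fun x => by simp)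
  simpa [rateChar] using this

lemma stronglyMeasurable_cumChar [SFinite σ] (hh : Measurable h) (ξ : ℝ) :
    StronglyMeasurable (cumChar σ h ξ) :=
  stronglyMeasurable_setIntegral_Ioc (stronglyMeasurable_rateChar hh ξ)

lemma norm_cumChar_le [IsProbabilityMeasure σ] (ξ s : ℝ) : ‖cumChar σ h ξ s‖ ≤ |s| := by
  simpa [cumChar] using norm_setIntegral_Ioc_le (fun t => norm_rateChar_le (σ := σ) (h := h) ξ t) s

lemma norm_cumChar_div_pow_le [IsProbabilityMeasure σ] (ξ s : ℝ) (p : ℕ) :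
    ‖(cumChar σ h ξ s / s) ^ p‖ ≤ 1 := by
  rw [norm_pow, norm_div, Complex.norm_real]
  refine pow_le_one₀ (by positivity) (div_le_one_of_le₀ (norm_cumChar_le ξ s) (norm_nonneg _))

lemma cumChar_zero [IsProbabilityMeasure σ] {s : ℝ} (hs : 0 ≤ s) : cumChar σ h 0 s = s := by
  simp [cumChar, rateChar, measureReal_def, hs]

lemma cumChar_pow_succ [IsProbabilityMeasure σ] (hh : Measurable h) (ξ : ℝ) (p : ℕ) (s : ℝ) :
    cumChar σ h ξ s ^ (p + 1) =
      (p + 1) * ∫ u in Set.Ioc 0 s, cumChar σ h ξ u ^ p * rateChar σ h ξ u :=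
  setIntegral_Ioc_pow_succ (stronglyMeasurable_rateChar hh ξ) (norm_rateChar_le ξ) p s

end CharFun

section Law

variable {d : ℕ} {Ω : Type*} {α : ℝ}
  {σ : Measure (EuclideanSpace ℝ (Fin d))} {τ : ℕ → Ω → ℝ} {Δ : ℕ → Ω → EuclideanSpace ℝ (Fin d)}
  {h : ℝ × EuclideanSpace ℝ (Fin d) → ℝ}

lemma character_partialSum_succ (ξ : ℝ) (ω : Ω) (k : ℕ) :
    character ξ (partialSum τ Δ h ω (k + 1)) =
      character ξ (partialSum τ Δ h ω k) * character ξ (h (arrival τ k ω, Δ k ω)) := by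
  rw [partialSum, Finset.sum_range_succ, character_add]
  rfl

lemma measurable_translate_integral {G : ℝ → ℂ} (hG : Measurable G) (hα : 0 < α) :
    Measurable (fun t => ∫ u, G (t + u) ∂expMeasure α) := by
  have := isProbabilityMeasure_expMeasure hα
  exact (hG.comp measurable_add).stronglyMeasurable.integral_prod_right'.measurable

lemma norm_translate_integral_le {G : ℝ → ℂ} {D : ℝ} (hD : ∀ t, ‖G t‖ ≤ D) (hα : 0 < α) (t : ℝ) :
    ‖∫ u, G (t + u) ∂expMeasure α‖ ≤ D := by
  have := isProbabilityMeasure_expMeasure hα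
  have := norm_integral_le_of_norm_le_const (μ := expMeasure α) (f := fun u => G (t + u)) (C := D)
    (ae_of_all _ fun x => hD _)
  simpa using this

variable [mΩ : MeasurableSpace Ω] {P : Measure Ω}

namespace IsInput

lemma measurable_character_past (hi : IsInput P α σ τ Δ) (hh : Measurable h) (ξ : ℝ) {j k : ℕ}
    (hjk : j ≤ k) : Measurable[hi.past k] (fun ω => character ξ (partialSum τ Δ h ω j)) :=
  (measurable_character ξ).comp (hi.measurable_partialSum_past hh hjk)

variable [IsProbabilityMeasure P] [IsProbabilityMeasure σ]

lemma integral_mul_term (hi : IsInput P α σ τ Δ) (hα : 0 < α) {k : ℕ} {Y : Ω → ℂ}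
    (hY : Measurable[hi.past k] Y) {C : ℝ} (hC : ∀ ω, ‖Y ω‖ ≤ C)
    {f : ℝ × EuclideanSpace ℝ (Fin d) → ℂ} (hf : Measurable f) {D : ℝ} (hD : ∀ z, ‖f z‖ ≤ D) :
    ∫ ω, Y ω * f (arrival τ k ω, Δ k ω) ∂P =
      ∫ ω, Y ω * ∫ u, ∫ x, f (startTime τ k ω + u, x) ∂σ ∂expMeasure α ∂P := by
  have := isProbabilityMeasure_expMeasure hα
  have hX : Measurable[hi.past k] (fun ω => (Y ω, startTime τ k ω)) :=
    hY.prodMk (hi.measurable_startTime_past k)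
  have hYm : Measurable Y := hY.mono (hi.past.le k) le_rfl
  have h1 := hi.integral_mark hX
    (f := fun w : (ℂ × ℝ) × ℝ × EuclideanSpace ℝ (Fin d) => w.1.1 * f (w.1.2 + w.2.1, w.2.2))
    (by apply Measurable.stronglyMeasurable; fun_prop) ?_
  · simp_rw [arrival_eq_startTime_add]
    rw [h1]
    congr 1; funext ω
    simp only [integral_const_mul]
    congr 1
    refine integral_prod _ (Integrable.of_bound (C := D) ?_ (ae_of_all _ fun z => hD _))
    exact Measurable.aestronglyMeasurable (by fun_prop)
  · have hC0 : ∀ ω, 0 ≤ C := fun ω => (norm_nonneg _).trans (hC ω)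
    refine Integrable.of_bound (C := C * D) ?_ (ae_of_all _ fun ω => ?_)
    · have a1 := hi.measurable_startTime k
      have a2 := hi.measurable_τ k
      have a3 := hi.measurable_Δ k
      exact Measurable.aestronglyMeasurable (by fun_prop)
    · rw [norm_mul]
      exact mul_le_mul (hC ω) (hD _) (norm_nonneg _) (hC0 ω)

lemma integral_mul_arrival (hi : IsInput P α σ τ Δ) (hα : 0 < α) {k : ℕ} {Y : Ω → ℂ}
    (hY : Measurable[hi.past k] Y) {C : ℝ} (hC : ∀ ω, ‖Y ω‖ ≤ C)
    {G : ℝ → ℂ} (hG : Measurable G) {D : ℝ} (hD : ∀ t, ‖G t‖ ≤ D) :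
    ∫ ω, Y ω * G (arrival τ k ω) ∂P =
      ∫ ω, Y ω * ∫ u, G (startTime τ k ω + u) ∂expMeasure α ∂P := by
  have := hi.integral_mul_term hα hY hC (f := fun z => G z.1) (by fun_prop) (fun z => hD z.1)
  simpa using this

/-- Averaging out the mark of the current arrival. -/
lemma integral_mul_term_eq_arrival (hi : IsInput P α σ τ Δ) (hα : 0 < α) {k : ℕ} {Y : Ω → ℂ}
    (hY : Measurable[hi.past k] Y) {C : ℝ} (hC : ∀ ω, ‖Y ω‖ ≤ C)
    {f : ℝ × EuclideanSpace ℝ (Fin d) → ℂ} (hf : Measurable f) {D : ℝ} (hD : ∀ z, ‖f z‖ ≤ D) :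
    ∫ ω, Y ω * f (arrival τ k ω, Δ k ω) ∂P =
      ∫ ω, Y ω * ∫ x, f (arrival τ k ω, x) ∂σ ∂P := by
  rw [hi.integral_mul_term hα hY hC hf hD,
    hi.integral_mul_arrival hα hY hC (G := fun t => ∫ x, f (t, x) ∂σ)
      hf.stronglyMeasurable.integral_prod_right'.measurable (D := D) fun t => ?_]
  have := norm_integral_le_of_norm_le_const (μ := σ) (f := fun x => f (t, x)) (C := D)
    (ae_of_all _ fun x => hD _)
  simpa using this

/-- The joint law of the sum over the first `p` arrivals and the next arrival time. -/
lemma integral_character_mul_arrival (hi : IsInput P α σ τ Δ) (hα : 0 < α) (hh : Measurable h)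
    (ξ : ℝ) (p : ℕ) {G : ℝ → ℂ} (hG : Measurable G) {D : ℝ} (hD : ∀ t, ‖G t‖ ≤ D) :
    ∫ ω, character ξ (partialSum τ Δ h ω p) * G (arrival τ p ω) ∂P =
      (α ^ p / p.factorial : ℂ) * ∫ s, cumChar σ h ξ s ^ p * G s ∂expMeasure α := by
  have := isProbabilityMeasure_expMeasure hα
  induction p generalizing G D with
  | zero =>
    rw [hi.integral_mul_arrival hα (hi.measurable_character_past hh ξ le_rfl)
      (C := 1) (by simp) hG hD]
    simp [partialSum, startTime]
  | succ p ih =>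
    have hD0 : 0 ≤ D := (norm_nonneg _).trans (hD 0)
    set K : ℝ → ℂ := fun t => ∫ u, G (t + u) ∂expMeasure α with hK
    have hKm : Measurable K := measurable_translate_integral hG hα
    have hKb : ∀ t, ‖K t‖ ≤ D := norm_translate_integral_le hD hα
    have hqm := (stronglyMeasurable_rateChar (σ := σ) hh ξ)
    have hφm := (stronglyMeasurable_cumChar (σ := σ) hh ξ)
    rw [hi.integral_mul_arrival hα (hi.measurable_character_past hh ξ le_rfl) (C := 1) (by simp)
      hG hD]
    -- The last inter-arrival time has been averaged into `K`. Averaging the mark of arrival `p`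
    -- next produces `rateChar`, and the induction hypothesis applies with test function `rateChar *
    -- K`.
    have h1 : ∫ ω, character ξ (partialSum τ Δ h ω (p + 1)) *
          ∫ u, G (startTime τ (p + 1) ω + u) ∂expMeasure α ∂P =
        ∫ ω, character ξ (partialSum τ Δ h ω p) *
          (fun z => character ξ (h z) * K z.1) (arrival τ p ω, Δ p ω) ∂P := by
      congr 1; funext ω
      rw [character_partialSum_succ, mul_assoc]
      rfl
    rw [h1, hi.integral_mul_term_eq_arrival hα (hi.measurable_character_past hh ξ le_rfl)
      (C := 1) (by simp) (f := fun z => character ξ (h z) * K z.1) (by fun_prop) (D := D)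
      (fun z => by simpa using hKb _)]
    simp only [integral_mul_const]
    have h2 := ih (G := fun t => rateChar σ h ξ t * K t) (D := D)
        (hqm.measurable.mul hKm) fun t => by
      rw [norm_mul]
      calc _ ≤ 1 * D := mul_le_mul (norm_rateChar_le ξ t) (hKb t) (norm_nonneg _) zero_le_one
        _ = D := one_mul D
    refine h2.trans ?_
    have hFi : Integrable (fun s => cumChar σ h ξ s ^ p * rateChar σ h ξ s) (expMeasure α) := by
      refine (integrable_pow_expMeasure hα p).norm.mono'
        ((hφm.pow p).mul hqm).aestronglyMeasurable (ae_of_all _ fun s => ?_)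
      rw [norm_mul, norm_pow, norm_pow]
      calc _ ≤ |s| ^ p * 1 := by
            gcongr
            · exact norm_cumChar_le ξ s
            · exact norm_rateChar_le ξ s
        _ = ‖s‖ ^ p := by simp
    -- This produces `α ∫ φ ^ p q` up to `v`, which is `α φ ^ (p + 1) / (p + 1)`; hence the
    -- factorial.
    have h3 := integral_mul_integral_translate_expMeasure hα hFi ((hφm.pow p).mul hqm)
      hG.stronglyMeasurable hD
    simp_rw [← mul_assoc]
    rw [h3, ← integral_const_mul, ← integral_const_mul]
    congr 1; funext v
    rw [cumChar_pow_succ hh ξ p v, Nat.factorial_succ]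
    have : ((p : ℂ) + 1) ≠ 0 := by exact_mod_cast Nat.succ_ne_zero p
    have h4 : (p.factorial : ℂ) ≠ 0 := by exact_mod_cast p.factorial_ne_zero
    push_cast
    field_simp
    rw [pow_succ]
    change Complex.ofReal α ^ p * Complex.ofReal α * _ * _ =
      _ * _ * (Complex.ofReal α ^ p * Complex.ofReal α)
    ring

/-- Given the arrival time of index `p`, the earlier arrivals are i.i.d. uniform up to order. -/
lemma integral_character_mul_arrival_eq (hi : IsInput P α σ τ Δ) (hα : 0 < α) (hh : Measurable h)
    (ξ : ℝ) (p : ℕ) {G : ℝ → ℂ} (hG : Measurable G) {D : ℝ} (hD : ∀ t, ‖G t‖ ≤ D) :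
    ∫ ω, character ξ (partialSum τ Δ h ω p) * G (arrival τ p ω) ∂P =
      ∫ ω, (cumChar σ h ξ (arrival τ p ω) / arrival τ p ω) ^ p * G (arrival τ p ω) ∂P := by
  have hφm := (stronglyMeasurable_cumChar (σ := σ) hh ξ).measurable
  -- At frequency `0` the formula describes the law of the arrival time alone, with weight `s ^ p`.
  -- That weight cancels the denominator placed in the test function.
  have h1 := hi.integral_character_mul_arrival hα hh 0 p
    (G := fun s => (cumChar σ h ξ s / s) ^ p * G s) (D := D) (by fun_prop) fun t => by
      rw [norm_mul]
      calc _ ≤ 1 * D := mul_le_mul (norm_cumChar_div_pow_le ξ t p) (hD t) (norm_nonneg _)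
            zero_le_one
        _ = D := one_mul D
  simp only [character_zero_left, one_mul] at h1
  rw [h1, hi.integral_character_mul_arrival hα hh ξ p hG hD]
  congr 1
  refine integral_congr_ae ?_
  filter_upwards [ae_expMeasure_pos] with s hs
  rw [cumChar_zero hs.le, ← mul_assoc, ← mul_pow, mul_div_cancel₀]
  exact_mod_cast hs.ne'

/-- Averaging out the arrivals of index `k, …, k + j - 1`. -/
lemma exists_integral_character_sub (hi : IsInput P α σ τ Δ) (hα : 0 < α) (hh : Measurable h)
    (ξ : ℝ) (k j : ℕ) {G : ℝ → ℂ} (hG : Measurable G) (hG1 : ∀ t, ‖G t‖ ≤ 1) :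
    ∃ H : ℝ → ℂ, Measurable H ∧ (∀ t, ‖H t‖ ≤ 1) ∧
      ∀ Y : Ω → ℂ, Measurable[hi.past k] Y → (∀ ω, ‖Y ω‖ ≤ 1) →
        ∫ ω, Y ω * character ξ (partialSum τ Δ h ω (k + j) - partialSum τ Δ h ω k) *
          G (startTime τ (k + j) ω) ∂P = ∫ ω, Y ω * H (startTime τ k ω) ∂P := by
  have := isProbabilityMeasure_expMeasure hα
  induction j generalizing G with
  | zero => exact ⟨G, hG, hG1, fun Y _ _ => by simp⟩
  | succ j ih =>
    -- `V` absorbs the last arrival, seen from the start of its inter-arrival period, so that one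
    -- arrival fewer remains.
    set V : ℝ → ℂ := fun t => ∫ u, rateChar σ h ξ (t + u) * G (t + u) ∂expMeasure α with hV
    have hqm := (stronglyMeasurable_rateChar (σ := σ) hh ξ).measurable
    have hqG : ∀ t, ‖rateChar σ h ξ t * G t‖ ≤ 1 := fun t => by
      rw [norm_mul]
      exact mul_le_one₀ (norm_rateChar_le ξ t) (norm_nonneg _) (hG1 t)
    obtain ⟨H, hHm, hH1, hH⟩ := ih (G := V)
      (measurable_translate_integral (G := fun t => rateChar σ h ξ t * G t) (hqm.mul hG) hα)
      (norm_translate_integral_le hqG hα)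
    refine ⟨H, hHm, hH1, fun Y hY hY1 => ?_⟩
    rw [← hH Y hY hY1]
    have hYm : Measurable[hi.past (k + j)] (fun ω => Y ω *
        character ξ (partialSum τ Δ h ω (k + j) - partialSum τ Δ h ω k)) :=
      (hY.mono (hi.past.mono (Nat.le_add_right k j)) le_rfl).mul
        ((measurable_character ξ).comp ((hi.measurable_partialSum_past hh le_rfl).sub
          (hi.measurable_partialSum_past hh (Nat.le_add_right k j))))
    have h1 := hi.integral_mul_term hα hYm (C := 1) (fun ω => by simpa using hY1 ω)
      (f := fun z => character ξ (h z) * G z.1) (by fun_prop) (D := 1)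
      (fun z => by simpa using hG1 _)
    simp only [integral_mul_const] at h1
    refine Eq.trans ?_ h1
    congr 1; funext ω
    have e1 : partialSum τ Δ h ω (k + (j + 1)) - partialSum τ Δ h ω k =
        (partialSum τ Δ h ω (k + j) - partialSum τ Δ h ω k) +
          h (arrival τ (k + j) ω, Δ (k + j) ω) := by
      rw [← add_assoc, partialSum, Finset.sum_range_succ]
      simp only [partialSum]
      ring
    rw [e1, character_add]
    change Y ω * (_ * _) * G (arrival τ (k + j) ω) = _
    ring

/-- The uniform representation of the first `p` arrivals only accepts test functions of the next
arrival time. So the later arrivals are collapsed into `H` and the mark of arrival `p` into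
`rateChar`, the replacement is made, and both averagings are undone. -/
lemma integral_character_partialSum (hi : IsInput P α σ τ Δ) (hα : 0 < α) (hh : Measurable h)
    (ξ : ℝ) (p j : ℕ) :
    ∫ ω, character ξ (partialSum τ Δ h ω (p + 1 + j)) ∂P =
      ∫ ω, (cumChar σ h ξ (arrival τ p ω) / arrival τ p ω) ^ p *
        character ξ (partialSum τ Δ h ω (p + 1 + j) - partialSum τ Δ h ω p) ∂P := by
  -- `H` does not depend on `Y`; it is used once before the replacement and once, with another `Y`,
  -- to restore the later arrivals.
  obtain ⟨H, hHm, hH1, hH⟩ := hi.exists_integral_character_sub hα hh ξ (p + 1) j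
    (G := fun _ => 1) measurable_const (by simp)
  simp only [mul_one, startTime_succ] at hH
  have hqm := (stronglyMeasurable_rateChar (σ := σ) hh ξ).measurable
  have hφm := (stronglyMeasurable_cumChar (σ := σ) hh ξ).measurable
  have hTm : Measurable[hi.past (p + 1)] (arrival τ p) := hi.measurable_startTime_past (p + 1)
  have hqH : ∀ t, ‖rateChar σ h ξ t * H t‖ ≤ 1 := fun t => by
    rw [norm_mul]
    exact mul_le_one₀ (norm_rateChar_le ξ t) (norm_nonneg _) (hH1 t)
  have hψ : Measurable (fun t : ℝ => (cumChar σ h ξ t / t) ^ p) := by fun_prop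
  calc ∫ ω, character ξ (partialSum τ Δ h ω (p + 1 + j)) ∂P
      = ∫ ω, character ξ (partialSum τ Δ h ω (p + 1)) *
          character ξ (partialSum τ Δ h ω (p + 1 + j) - partialSum τ Δ h ω (p + 1)) ∂P := by
        congr 1; funext ω
        rw [← character_add, add_sub_cancel]
    _ = ∫ ω, character ξ (partialSum τ Δ h ω (p + 1)) * H (arrival τ p ω) ∂P :=
        hH _ (hi.measurable_character_past hh ξ le_rfl) (by simp)
    _ = ∫ ω, character ξ (partialSum τ Δ h ω p) *
          (fun z => character ξ (h z) * H z.1) (arrival τ p ω, Δ p ω) ∂P := by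
        congr 1; funext ω
        rw [character_partialSum_succ, mul_assoc]
    _ = ∫ ω, character ξ (partialSum τ Δ h ω p) *
          (rateChar σ h ξ (arrival τ p ω) * H (arrival τ p ω)) ∂P := by
        rw [hi.integral_mul_term_eq_arrival hα (hi.measurable_character_past hh ξ le_rfl)
          (C := 1) (by simp) (f := fun z => character ξ (h z) * H z.1) (by fun_prop) (D := 1)
          (fun z => by simpa using hH1 _)]
        simp only [integral_mul_const]
        rfl
    _ = ∫ ω, (cumChar σ h ξ (arrival τ p ω) / arrival τ p ω) ^ p *
          (rateChar σ h ξ (arrival τ p ω) * H (arrival τ p ω)) ∂P :=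
        hi.integral_character_mul_arrival_eq hα hh ξ p
          (G := fun t => rateChar σ h ξ t * H t) (hqm.mul hHm) hqH
    _ = ∫ ω, (cumChar σ h ξ (arrival τ p ω) / arrival τ p ω) ^ p *
          character ξ (h (arrival τ p ω, Δ p ω)) * H (arrival τ p ω) ∂P := by
        have h1 := hi.integral_mul_term_eq_arrival hα (k := p) (Y := fun _ => 1) measurable_const
          (C := 1) (by simp)
          (f := fun z => (cumChar σ h ξ z.1 / z.1) ^ p * (character ξ (h z) * H z.1))
          (by fun_prop) (D := 1) (fun z => by
            rw [norm_mul, norm_mul, norm_character, one_mul]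
            exact mul_le_one₀ (norm_cumChar_div_pow_le ξ _ p) (norm_nonneg _) (hH1 _))
        simp only [one_mul, integral_const_mul, integral_mul_const] at h1
        simp_rw [mul_assoc]
        exact h1.symm
    _ = ∫ ω, (cumChar σ h ξ (arrival τ p ω) / arrival τ p ω) ^ p *
          character ξ (h (arrival τ p ω, Δ p ω)) *
          character ξ (partialSum τ Δ h ω (p + 1 + j) - partialSum τ Δ h ω (p + 1)) ∂P := by
        refine (hH _ ?_ fun ω => ?_).symm
        · exact (hψ.comp hTm).mul (hi.measurable_term_past (f := fun z => character ξ (h z))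
            (by fun_prop) p.lt_succ_self)
        · rw [norm_mul, norm_character, mul_one]
          exact norm_cumChar_div_pow_le ξ _ p
    _ = _ := by
        congr 1; funext ω
        rw [mul_assoc, ← character_add]
        congr 2
        simp only [partialSum, Finset.sum_range_succ _ p]
        ring

/-- The characteristic function of the series, with the first `p` arrivals averaged out given the
next one. -/
lemma integral_character_series (hi : IsInput P α σ τ Δ) (hα : 0 < α) (hσ : σ {0} = 0)
    (hk : IsKernel σ h) (ξ : ℝ) (p : ℕ) :
    ∫ ω, character ξ (series τ Δ h ω) ∂P =
      ∫ ω, (cumChar σ h ξ (arrival τ p ω) / arrival τ p ω) ^ p *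
        character ξ (series τ Δ h ω - partialSum τ Δ h ω p) ∂P := by
  have hh := hk.measurable
  have hφm := (stronglyMeasurable_cumChar (σ := σ) hh ξ).measurable
  have hψ : Measurable (fun t : ℝ => (cumChar σ h ξ t / t) ^ p) := by fun_prop
  have hψm : Measurable fun ω => (cumChar σ h ξ (arrival τ p ω) / arrival τ p ω) ^ p :=
    hψ.comp (hi.measurable_arrival p)
  have hconv : ∀ᵐ ω ∂P, Tendsto (fun j => partialSum τ Δ h ω (p + 1 + j)) atTop
      (𝓝 (series τ Δ h ω)) := by
    filter_upwards [hi.ae_tendsto_series hα hσ hk] with ω hω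
    exact hω.comp (tendsto_atTop_mono (fun j => Nat.le_add_left j (p + 1)) tendsto_id)
  have h1 : Tendsto (fun j => ∫ ω, character ξ (partialSum τ Δ h ω (p + 1 + j)) ∂P) atTop
      (𝓝 (∫ ω, character ξ (series τ Δ h ω) ∂P)) := by
    refine tendsto_integral_of_dominated_convergence (fun _ => 1) (fun j => ?_)
      (integrable_const _) (fun j => ae_of_all _ fun ω => by simp) ?_
    · exact ((measurable_character ξ).comp (hi.measurable_partialSum hh _)).aestronglyMeasurable
    · filter_upwards [hconv] with ω hω
      exact ((continuous_character ξ).tendsto _).comp hω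
  have h2 : Tendsto (fun j => ∫ ω, (cumChar σ h ξ (arrival τ p ω) / arrival τ p ω) ^ p *
        character ξ (partialSum τ Δ h ω (p + 1 + j) - partialSum τ Δ h ω p) ∂P) atTop
      (𝓝 (∫ ω, (cumChar σ h ξ (arrival τ p ω) / arrival τ p ω) ^ p *
        character ξ (series τ Δ h ω - partialSum τ Δ h ω p) ∂P)) := by
    refine tendsto_integral_of_dominated_convergence (fun _ => 1) (fun j => ?_)
      (integrable_const _) (fun j => ae_of_all _ fun ω => ?_) ?_
    · exact (hψm.mul ((measurable_character ξ).comp ((hi.measurable_partialSum hh _).sub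
        (hi.measurable_partialSum hh _)))).aestronglyMeasurable
    · rw [norm_mul, norm_character, mul_one]
      exact norm_cumChar_div_pow_le ξ _ p
    · filter_upwards [hconv] with ω hω
      exact (((continuous_character ξ).tendsto _).comp (hω.sub_const _)).const_mul _
  refine tendsto_nhds_unique h1 (h2.congr fun j => ?_)
  exact (hi.integral_character_partialSum hα hh ξ p j).symm

end IsInput

end Law

/-! ### The law of the series as a mixture of translated convolution powers -/

section Mixture

variable {d : ℕ} {σ : Measure (EuclideanSpace ℝ (Fin d))}
  {h : ℝ × EuclideanSpace ℝ (Fin d) → ℝ}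

lemma charFun_map_eq_integral_character {Ω : Type*} [MeasurableSpace Ω] {μ : Measure Ω}
    {X : Ω → ℝ} (hX : AEMeasurable X μ) (ξ : ℝ) :
    charFun (μ.map X) ξ = ∫ ω, character ξ (X ω) ∂μ := by
  rw [charFun_apply_real, integral_map hX]
  · rfl
  · exact (continuous_character ξ).aestronglyMeasurable

/-- The law of `p` independent pairs of a uniform variable on `[0, 1]` and a mark. -/
def uniformMarks (σ : Measure (EuclideanSpace ℝ (Fin d))) (p : ℕ) :
    Measure (Fin p → ℝ × EuclideanSpace ℝ (Fin d)) :=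
  Measure.pi fun _ => (volume.restrict (Set.Icc (0 : ℝ) 1)).prod σ

/-- The sum of the kernel over `p` arrivals with times rescaled to `[0, s]`. -/
def uniformSum (h : ℝ × EuclideanSpace ℝ (Fin d) → ℝ) {p : ℕ} (s : ℝ)
    (w : Fin p → ℝ × EuclideanSpace ℝ (Fin d)) : ℝ :=
  ∑ i, h (s * (w i).1, (w i).2)

lemma measurable_uniformSum (hh : Measurable h) {p : ℕ} :
    Measurable (fun z : ℝ × (Fin p → ℝ × EuclideanSpace ℝ (Fin d)) => uniformSum h z.1 z.2) := by
  unfold uniformSum; fun_prop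

variable [IsProbabilityMeasure σ]

lemma isProbabilityMeasure_restrict_unit :
    IsProbabilityMeasure (volume.restrict (Set.Icc (0 : ℝ) 1)) := ⟨by simp⟩

instance (p : ℕ) : IsProbabilityMeasure (uniformMarks σ p) := by
  have := isProbabilityMeasure_restrict_unit
  unfold uniformMarks; infer_instance

lemma charFun_imageMeasure (hh : Measurable h) (ξ : ℝ) (s : ℝ) :
    charFun (imageMeasure σ (Set.Icc 0 s) h) ξ = cumChar σ h ξ s := by
  rw [imageMeasure, charFun_map_eq_integral_character hh.aemeasurable, integral_prod,
    integral_Icc_eq_integral_Ioc]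
  · rfl
  · exact Integrable.of_bound (C := 1) (Measurable.aestronglyMeasurable (by fun_prop))
      (ae_of_all _ fun z => by simp)

lemma integral_character_uniformSum (hh : Measurable h) (ξ : ℝ) {s : ℝ} (hs : 0 < s) (p : ℕ) :
    ∫ w, character ξ (uniformSum h s w) ∂uniformMarks σ p = (cumChar σ h ξ s / s) ^ p := by
  have := isProbabilityMeasure_restrict_unit
  have h1 : ∀ w : Fin p → ℝ × EuclideanSpace ℝ (Fin d), character ξ (uniformSum h s w) =
      ∏ i, (fun z : ℝ × EuclideanSpace ℝ (Fin d) => character ξ (h (s * z.1, z.2))) (w i) := by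
    intro w
    simp only [character, uniformSum, ← Complex.exp_sum]
    push_cast
    rw [Finset.mul_sum, Finset.sum_mul]
  simp_rw [h1]
  rw [uniformMarks, integral_fintype_prod_eq_pow
    (fun z : ℝ × EuclideanSpace ℝ (Fin d) => character ξ (h (s * z.1, z.2))), Fintype.card_fin]
  congr 1
  rw [integral_prod, integral_Icc_eq_integral_Ioc]
  · change ∫ u in Set.Ioc (0 : ℝ) 1, rateChar σ h ξ (s * u) = _
    rw [← intervalIntegral.integral_of_le zero_le_one,
      intervalIntegral.integral_comp_mul_left _ hs.ne', mul_zero, mul_one,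
      intervalIntegral.integral_of_le hs.le, Complex.real_smul, Complex.ofReal_inv, cumChar]
    field_simp
  · exact Integrable.of_bound (C := 1) (Measurable.aestronglyMeasurable (by fun_prop))
      (ae_of_all _ fun z => by simp)

/-- Both sides have characteristic function `cumChar ^ p`. Rescaling the times puts all values of
`s` on one probability space, so that the mixture becomes the image of a single product measure. -/
lemma convPow_imageMeasure_eq (hh : Measurable h) {s : ℝ} (hs : 0 < s) (p : ℕ) :
    convPow (imageMeasure σ (Set.Icc 0 s) h) p =
      ENNReal.ofReal (s ^ p) • (uniformMarks σ p).map (uniformSum h s) := by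
  have hm : Measurable (uniformSum (p := p) h s) :=
    (measurable_uniformSum hh).comp (by fun_prop : Measurable fun w => (s, w))
  have : IsFiniteMeasure (ENNReal.ofReal (s ^ p) • (uniformMarks σ p).map (uniformSum h s)) :=
    Measure.smul_finite _ ENNReal.ofReal_ne_top
  refine Measure.ext_of_charFun ?_
  funext ξ
  have h1 : charFun (ENNReal.ofReal (s ^ p) • (uniformMarks σ p).map (uniformSum h s)) ξ =
      (s ^ p : ℝ) • charFun ((uniformMarks σ p).map (uniformSum h s)) ξ := by
    rw [charFun_apply_real, charFun_apply_real, integral_smul_measure,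
      ENNReal.toReal_ofReal (by positivity)]
  rw [charFun_convPow, charFun_imageMeasure hh, h1,
    charFun_map_eq_integral_character hm.aemeasurable, integral_character_uniformSum hh ξ hs,
    Complex.real_smul, Complex.ofReal_pow, ← mul_pow, mul_div_cancel₀]
  exact_mod_cast hs.ne'

lemma measureReal_uniformSum (hh : Measurable h) {s : ℝ} (hs : 0 < s) (p : ℕ) (B : Set ℝ) :
    ((uniformMarks σ p).map (uniformSum h s)).real B =
      (s ^ p)⁻¹ * (convPow (imageMeasure σ (Set.Icc 0 s) h) p).real B := by
  have h0 : 0 < s ^ p := by positivity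
  rw [convPow_imageMeasure_eq hh hs, measureReal_ennreal_smul_apply,
    ENNReal.toReal_ofReal h0.le, inv_mul_cancel_left₀ h0.ne']

lemma convPow_imageMeasure_Icc_absolutelyContinuous (hh : Measurable h) {p : ℕ}
    (hac : convPow (imageMeasure σ (Set.Ici 0) h) p ≪ volume) (s : ℝ) :
    convPow (imageMeasure σ (Set.Icc 0 s) h) p ≪ volume := by
  have : SFinite (imageMeasure σ (Set.Ici 0) h) := by unfold imageMeasure; infer_instance
  refine (Measure.absolutelyContinuous_of_le (convPow_mono ?_ p)).trans hac
  exact Measure.map_mono (Measure.prod_mono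
    (Measure.restrict_mono Set.Icc_subset_Ici_self le_rfl) le_rfl) hh

variable {Ω : Type*} [mΩ : MeasurableSpace Ω] {P : Measure Ω} [IsProbabilityMeasure P] {α : ℝ}
  {τ : ℕ → Ω → ℝ} {Δ : ℕ → Ω → EuclideanSpace ℝ (Fin d)}

/-- The series has the law of its remainder after `p` terms plus an independent sample of `p`
arrivals, uniformly distributed up to the arrival time of index `p`. -/
lemma IsInput.map_series_eq (hi : IsInput P α σ τ Δ) (hα : 0 < α) (hσ : σ {0} = 0)
    (hk : IsKernel σ h) (p : ℕ) {R : Ω → ℝ} (hR : Measurable R)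
    (hRae : ∀ᵐ ω ∂P, R ω = series τ Δ h ω - partialSum τ Δ h ω p) :
    P.map (series τ Δ h) = (P.prod (uniformMarks σ p)).map
      (fun z => uniformSum h (arrival τ p z.1) z.2 + R z.1) := by
  have hh := hk.measurable
  have hTm := hi.measurable_arrival p
  have hm : Measurable (fun z : Ω × (Fin p → ℝ × EuclideanSpace ℝ (Fin d)) =>
      uniformSum h (arrival τ p z.1) z.2 + R z.1) :=
    ((measurable_uniformSum hh).comp ((hTm.comp measurable_fst).prodMk measurable_snd)).add
      (hR.comp measurable_fst)
  refine Measure.ext_of_charFun ?_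
  funext ξ
  rw [charFun_map_eq_integral_character (hi.aemeasurable_series hα hσ hk),
    charFun_map_eq_integral_character hm.aemeasurable, hi.integral_character_series hα hσ hk ξ p,
    integral_prod]
  · refine integral_congr_ae ?_
    filter_upwards [hRae, hi.ae_interarrival_pos] with ω h1 h2
    have hpos : 0 < arrival τ p ω := Finset.sum_pos (fun j _ => h2 j) (by simp)
    simp_rw [character_add]
    rw [integral_mul_const, integral_character_uniformSum hh ξ hpos, h1]
  · exact Integrable.of_bound (C := 1)
      ((measurable_character ξ).comp hm).aestronglyMeasurable (ae_of_all _ fun z => by simp)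

/-- Fubini with the uniform sample integrated first: for fixed `ω` both the arrival time and the
translation are constants. -/
lemma IsInput.measureReal_map_series (hi : IsInput P α σ τ Δ) (hα : 0 < α) (hσ : σ {0} = 0)
    (hk : IsKernel σ h) (p : ℕ) {R : Ω → ℝ} (hR : Measurable R)
    (hRae : ∀ᵐ ω ∂P, R ω = series τ Δ h ω - partialSum τ Δ h ω p) {A : Set ℝ}
    (hA : MeasurableSet A) :
    Integrable (fun ω => ((uniformMarks σ p).map (uniformSum h (arrival τ p ω))).real
      ((fun y => y + R ω) ⁻¹' A)) P ∧
    (P.map (series τ Δ h)).real A =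
      ∫ ω, ((uniformMarks σ p).map (uniformSum h (arrival τ p ω))).real
        ((fun y => y + R ω) ⁻¹' A) ∂P := by
  have hh := hk.measurable
  have hTm := hi.measurable_arrival p
  have hm : Measurable (fun z : Ω × (Fin p → ℝ × EuclideanSpace ℝ (Fin d)) =>
      uniformSum h (arrival τ p z.1) z.2 + R z.1) :=
    ((measurable_uniformSum hh).comp ((hTm.comp measurable_fst).prodMk measurable_snd)).add
      (hR.comp measurable_fst)
  set D := (fun z : Ω × (Fin p → ℝ × EuclideanSpace ℝ (Fin d)) =>
      uniformSum h (arrival τ p z.1) z.2 + R z.1) ⁻¹' A with hD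
  have hDm : MeasurableSet D := hA.preimage hm
  have hsec : ∀ ω, ((uniformMarks σ p).map (uniformSum h (arrival τ p ω)))
      ((fun y => y + R ω) ⁻¹' A) = uniformMarks σ p (Prod.mk ω ⁻¹' D) := by
    intro ω
    rw [Measure.map_apply _ (hA.preimage (by fun_prop))]
    · rfl
    · exact (measurable_uniformSum hh).comp
        (by fun_prop : Measurable fun w => (arrival τ p ω, w))
  have hmeas : Measurable fun ω => uniformMarks σ p (Prod.mk ω ⁻¹' D) :=
    measurable_measure_prodMk_left hDm
  simp only [measureReal_def, hsec]
  constructor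
  · refine Integrable.of_bound (C := 1) hmeas.ennreal_toReal.aestronglyMeasurable
      (ae_of_all _ fun ω => ?_)
    rw [Real.norm_eq_abs, abs_of_nonneg ENNReal.toReal_nonneg]
    exact measureReal_le_one
  · rw [hi.map_series_eq hα hσ hk p hR hRae, Measure.map_apply hm hA, ← hD,
      Measure.prod_apply hDm, integral_toReal hmeas.aemeasurable
        (ae_of_all _ fun ω => measure_lt_top _ _)]

end Mixture

/-! ### Convergence in variation -/

section Variation

variable {d : ℕ} {σ : Measure (EuclideanSpace ℝ (Fin d))} [IsProbabilityMeasure σ]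
  {h : ℝ × EuclideanSpace ℝ (Fin d) → ℝ} {hs : ℕ → ℝ × EuclideanSpace ℝ (Fin d) → ℝ}

/-- Two errors are added. Replacing `hs n` by `h` is controlled in variation, hence uniformly over
the translated sets; replacing `r n` by `r₀` uses the density of the limit alone. -/
lemma tendsto_measureReal_uniformSum_sub (hh : Measurable h) (hsm : ∀ n, Measurable (hs n))
    {p : ℕ} (hac : convPow (imageMeasure σ (Set.Ici 0) h) p ≪ volume) {s : ℝ} (hspos : 0 < s)
    (hvar : TendstoInVariation (fun n => convPow (imageMeasure σ (Set.Icc 0 s) (hs n)) p)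
      (convPow (imageMeasure σ (Set.Icc 0 s) h) p))
    {r : ℕ → ℝ} {r₀ : ℝ} (hr : Tendsto r atTop (𝓝 r₀)) {A : ℕ → Set ℝ}
    (hA : ∀ n, MeasurableSet (A n)) :
    Tendsto (fun n => ((uniformMarks σ p).map (uniformSum (hs n) s)).real
        ((fun y => y + r n) ⁻¹' A n) -
      ((uniformMarks σ p).map (uniformSum h s)).real ((fun y => y + r₀) ⁻¹' A n))
      atTop (𝓝 0) := by
  have h1 := hvar.tendsto_measureReal_sub (A := fun n => (fun y => y + r n) ⁻¹' A n)
    fun n => (hA n).preimage (by fun_prop)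
  have h2 := tendsto_measureReal_translate_sub
    (convPow_imageMeasure_Icc_absolutelyContinuous hh hac s) hr hA
  have h3 := (h1.add h2).const_mul (s ^ p)⁻¹
  rw [add_zero, mul_zero] at h3
  refine h3.congr fun n => ?_
  rw [measureReal_uniformSum (hsm n) hspos, measureReal_uniformSum hh hspos]
  ring

variable {Ω : Type*} [mΩ : MeasurableSpace Ω] {P : Measure Ω} [IsProbabilityMeasure P] {α : ℝ}
  {τ : ℕ → Ω → ℝ} {Δ : ℕ → Ω → EuclideanSpace ℝ (Fin d)}

lemma IsInput.tendstoInVariation_series (hi : IsInput P α σ τ Δ) (hα : 0 < α) (hσ : σ {0} = 0)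
    (hker : IsKernel σ h) (hsker : ∀ n, IsKernel σ (hs n))
    (hdrift : Tendsto (fun n => drift σ (hs n)) atTop (𝓝 (drift σ h)))
    (hsq : Tendsto (fun n => truncSq σ (fun z => hs n z - h z)) atTop (𝓝 0)) {p : ℕ}
    (hac : convPow (imageMeasure σ (Set.Ici 0) h) p ≪ volume)
    (hvar : ∀ t : ℝ, 0 < t →
      TendstoInVariation (fun n => convPow (imageMeasure σ (Set.Icc 0 t) (hs n)) p)
        (convPow (imageMeasure σ (Set.Icc 0 t) h) p)) :
    TendstoInVariation (fun n => P.map (series τ Δ (hs n))) (P.map (series τ Δ h)) := by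
  have hh := hker.measurable
  have hsm := fun n => (hsker n).measurable
  have hRm : ∀ k : ℝ × EuclideanSpace ℝ (Fin d) → ℝ, IsKernel σ k →
      AEMeasurable (fun ω => series τ Δ k ω - partialSum τ Δ k ω p) P := fun k hk =>
    (hi.aemeasurable_series hα hσ hk).sub (hi.measurable_partialSum hk.measurable p).aemeasurable
  -- The series, as a limit with a default value off the convergence set, is only almost everywhere
  -- measurable; measurable versions are used for Fubini.
  set R : Ω → ℝ := (hRm h hker).mk _ with hRdef
  set Rs : ℕ → Ω → ℝ := fun n => (hRm (hs n) (hsker n)).mk _ with hRsdef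
  have hRae : ∀ᵐ ω ∂P, R ω = series τ Δ h ω - partialSum τ Δ h ω p :=
    (hRm h hker).ae_eq_mk.symm
  have hRsae : ∀ n, ∀ᵐ ω ∂P, Rs n ω = series τ Δ (hs n) ω - partialSum τ Δ (hs n) ω p := fun n =>
    (hRm (hs n) (hsker n)).ae_eq_mk.symm
  have hconv : TendstoInMeasure P Rs atTop R :=
    (tendstoInMeasure_sub (hi.tendstoInMeasure_series hα hσ hker hsker
      (intensity_abs_eq_one hh hac) hdrift hsq)
      (hi.tendstoInMeasure_partialSum hα hσ hh hsm hsq p)).congr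
      (fun n => (hRm (hs n) (hsker n)).ae_eq_mk) (hRm h hker).ae_eq_mk
  refine tendstoInVariation_of_forall_measurableSet fun A hA => ?_
  -- Convergence in probability of the remainders yields almost sure convergence only along
  -- subsequences.
  refine tendsto_of_subseq_tendsto fun ns hns => ?_
  obtain ⟨ms, hms, hae⟩ := (hconv.comp hns).exists_seq_tendsto_ae
  refine ⟨ms, ?_⟩
  have hsub : Tendsto (fun j => ns (ms j)) atTop atTop := hns.comp hms.tendsto_atTop
  have hF := fun j => hi.measureReal_map_series hα hσ (hsker (ns (ms j))) p
    (hRm _ (hsker (ns (ms j)))).measurable_mk (hRsae _) (hA (ns (ms j)))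
  have hG := fun j => hi.measureReal_map_series hα hσ hker p
    (hRm _ hker).measurable_mk hRae (hA (ns (ms j)))
  have key : Tendsto (fun j => ∫ ω,
      (((uniformMarks σ p).map (uniformSum (hs (ns (ms j))) (arrival τ p ω))).real
          ((fun y => y + Rs (ns (ms j)) ω) ⁻¹' A (ns (ms j))) -
        ((uniformMarks σ p).map (uniformSum h (arrival τ p ω))).real
          ((fun y => y + R ω) ⁻¹' A (ns (ms j)))) ∂P) atTop (𝓝 (∫ _, (0 : ℝ) ∂P)) := by
    refine tendsto_integral_of_dominated_convergence (fun _ => 1)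
      (fun j => ((hF j).1.sub (hG j).1).aestronglyMeasurable) (integrable_const _)
      (fun j => ae_of_all _ fun ω => ?_) ?_
    · have hm1 : ∀ k : ℝ × EuclideanSpace ℝ (Fin d) → ℝ, ∀ B : Set ℝ,
          ((uniformMarks σ p).map (uniformSum k (arrival τ p ω))).real B ∈ Set.Icc (0 : ℝ) 1 := by
        intro k B
        refine ⟨measureReal_nonneg, (measureReal_mono (Set.subset_univ _)).trans ?_⟩
        by_cases hk : AEMeasurable (uniformSum k (arrival τ p ω)) (uniformMarks σ p)
        · have := Measure.isProbabilityMeasure_map hk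
          exact measureReal_le_one
        · simp [Measure.map_of_not_aemeasurable hk]
      rw [Real.norm_eq_abs, abs_le]
      have a1 := hm1 (hs (ns (ms j))) ((fun y => y + Rs (ns (ms j)) ω) ⁻¹' A (ns (ms j)))
      have a2 := hm1 h ((fun y => y + R ω) ⁻¹' A (ns (ms j)))
      constructor <;> linarith [a1.1, a1.2, a2.1, a2.2]
    · filter_upwards [hae, hi.ae_interarrival_pos] with ω h1 h2
      have hpos : 0 < arrival τ p ω := Finset.sum_pos (fun j _ => h2 j) (by simp)
      -- Here `ω` is fixed, so the arrival time is a positive constant and the remainders are a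
      -- convergent sequence of reals.
      exact tendsto_measureReal_uniformSum_sub hh (fun j => hsm (ns (ms j))) hac hpos
        (Tendsto.comp (hvar _ hpos) hsub) h1 fun j => hA _
  rw [integral_zero] at key
  refine key.congr fun j => ?_
  rw [(hF j).2, (hG j).2, ← integral_sub (hF j).1 (hG j).1]

end Variation

end ShotNoise

end

theorem proposition3 {d : ℕ} {Ω : Type*} [MeasurableSpace Ω] (P : Measure Ω)
    [IsProbabilityMeasure P] (α : ℝ) (hα : 0 < α)
    (σ : Measure (EuclideanSpace ℝ (Fin d))) [IsProbabilityMeasure σ] (hσ : σ {0} = 0)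
    (τ : ℕ → Ω → ℝ) (Δ : ℕ → Ω → EuclideanSpace ℝ (Fin d))
    (hinput : ShotNoise.IsInput P α σ τ Δ)
    (hs : ℕ → ℝ × EuclideanSpace ℝ (Fin d) → ℝ) (h : ℝ × EuclideanSpace ℝ (Fin d) → ℝ)
    (hs_kernel : ∀ n, ShotNoise.IsKernel σ (hs n)) (h_kernel : ShotNoise.IsKernel σ h)
    (h_drift : Tendsto (fun n => ShotNoise.drift σ (hs n)) atTop (𝓝 (ShotNoise.drift σ h)))
    (h_sq : Tendsto (fun n => ShotNoise.truncSq σ (fun z => hs n z - h z)) atTop (𝓝 0))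
    (p : ℕ) (hp : 1 ≤ p)
    (h_ac : ShotNoise.convPow (ShotNoise.imageMeasure σ (Set.Ici 0) h) p ≪ volume)
    (h_var : ∀ t : ℝ, 0 < t →
      ShotNoise.TendstoInVariation
        (fun n => ShotNoise.convPow (ShotNoise.imageMeasure σ (Set.Icc 0 t) (hs n)) p)
        (ShotNoise.convPow (ShotNoise.imageMeasure σ (Set.Icc 0 t) h) p)) :
    (∀ n, ∀ᵐ ω ∂P, ∃ l : ℝ, Tendsto (ShotNoise.partialSum τ Δ (hs n) ω) atTop (𝓝 l)) ∧
    (∀ᵐ ω ∂P, ∃ l : ℝ, Tendsto (ShotNoise.partialSum τ Δ h ω) atTop (𝓝 l)) ∧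
    ShotNoise.TendstoInVariation
      (fun n => P.map (ShotNoise.series τ Δ (hs n))) (P.map (ShotNoise.series τ Δ h)) := by
  exact ⟨fun n => hinput.ae_exists_tendsto_partialSum hα hσ (hs_kernel n),
    hinput.ae_exists_tendsto_partialSum hα hσ h_kernel,
    hinput.tendstoInVariation_series hα hσ h_kernel hs_kernel h_drift h_sq h_ac h_var⟩
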